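/- For each integer $n \ge 1$ let $M_n$ be the random $n \times n$ Bernoulli matrix, i.e. the matrix whose entries $a_{ij}$ are independent random variables taking each of the values $+1$ and $-1$ with probability $1/2$, and let $\mathrm{Per}(M_n) = \sum_{\sigma \in S_n} \prod_{i=1}^n a_{i\sigma(i)}$ denote its permanent. There is an absolute constant $c > 0$ such that for every $\varepsilon > 0$ and all $n$ sufficiently large depending on $\varepsilon$, $$\mathbf{P}\left( |\mathrm{Per}(M_n)| \ge n^{(\frac12 - \varepsilon) n} \right) \ge 1 - n^{-c}.$$ -/

import Mathlib

open MeasureTheory ProbabilityTheory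
open scoped ENNReal

/-- `X` is an `n × n` random Bernoulli matrix on the probability space `(Ω, μ)`: its `n²` entries
are independent random variables, each taking the values `1` and `-1` with probability `1/2`. -/
structure IsBernoulliMatrix {Ω : Type*} [MeasurableSpace Ω] (μ : Measure Ω) {n : ℕ}
    (X : Ω → Matrix (Fin n) (Fin n) ℝ) : Prop where
  measurable_entry : ∀ i j, Measurable (fun ω => X ω i j)
  prob_one : ∀ i j, μ {ω | X ω i j = 1} = (1 / 2 : ℝ≥0∞)
  prob_neg_one : ∀ i j, μ {ω | X ω i j = -1} = (1 / 2 : ℝ≥0∞)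
  indep : iIndepFun (fun (p : Fin n × Fin n) (ω : Ω) => X ω p.1 p.2) μ

/-! Reveal the matrix one line at a time and follow the energy, the sum of squares of all maximal
minors (permanents) of the revealed lines. Adding a line of signs to k lines of length N turns the
vector of minors into a signed sum of N vectors whose squared norms add up to (N - k) times the
energy. A dimension-free Littlewood–Offord inequality therefore multiplies the energy by almost n
while linearly many lines are missing (`unifProb_energy_rowStep_lt_mul_le`). Individual failures are
not rare enough to be excluded, but εn of them together are: their probability beats the entropy
factor 2^n (`unifProb_slowGrowth_le`). Even a failing step loses at most a factor 4N, except with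
probability exponentially small in the number of missing lines (`unifProb_energy_rowStep_lt_le`).
Hence the energy reaches n^((1 - O(ε))n).

That last bound degenerates when few lines are missing, so the end is handled with r ≈ (log₂ n)/40.
Set aside s = 5r rows, leaving N = n - s rows, and consider any t = 6r columns. Exposing the other N
- r columns gives large energy with failure O(2^(-r)). Among the t candidates, r columns can then be
picked adaptively to complete an N × N minor, since each candidate works with probability at least
1/3 (`unifProb_not_exists_selection_le`). Deleting the s unused candidates thus leaves a minor that
is large.

As this holds for typical t-tuples, double counting shows that large minors are abundant, in the
form of a tree of depth s with branching m ≈ √n (`unifProb_not_rich_le`). Abundance lets the s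
reserved rows be added by scalar Littlewood–Offord with total loss 2^s / √(m/2), without lowering
the threshold (`Rich.unifProb_lt_le`). All failures are exponentially small in r, that is, a
negative power of n. -/

open scoped BigOperators

/-- The probability of `p` under the uniform distribution on a finite type. -/
noncomputable def unifProb {Ω : Type*} [Fintype Ω] (p : Ω → Prop) : ℝ :=
  open Classical in 𝔼 ω, if p ω then (1 : ℝ) else 0

/-! ### Finite uniform probability: union bounds, Fubini, Markov, resampling. -/

section UnifProb
variable {Ω Ω' : Type*} [Fintype Ω] [Fintype Ω']

theorem unifProb_eq_card_div (p : Ω → Prop) [DecidablePred p] :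
    unifProb p = ((Finset.univ.filter p).card : ℝ) / Fintype.card Ω := by
  classical
  rw [unifProb, Fintype.expect_eq_sum_div_card]
  congr 1
  rw [← Finset.sum_boole]
  exact Finset.sum_congr rfl fun i _ => by congr

theorem unifProb_nonneg (p : Ω → Prop) : 0 ≤ unifProb p := by
  classical
  exact Finset.expect_nonneg fun i _ => by split_ifs <;> norm_num

theorem unifProb_mono {p q : Ω → Prop} (h : ∀ ω, p ω → q ω) : unifProb p ≤ unifProb q := by
  classical
  refine Finset.expect_le_expect fun i _ => ?_
  by_cases hp : p i
  · simp [hp, h i hp]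
  · simp only [hp, if_false]; split_ifs <;> norm_num

theorem unifProb_le_one (p : Ω → Prop) : unifProb p ≤ 1 := by
  classical
  rw [unifProb_eq_card_div]
  exact div_le_one_of_le₀ (by exact_mod_cast Finset.card_le_univ _) (by positivity)

theorem unifProb_or_le (p q : Ω → Prop) :
    unifProb (fun ω => p ω ∨ q ω) ≤ unifProb p + unifProb q := by
  classical
  unfold unifProb
  rw [← Finset.expect_add_distrib]
  refine Finset.expect_le_expect fun i _ => ?_
  by_cases hp : p i <;> by_cases hq : q i <;> simp [hp, hq]

theorem unifProb_le_add {p q r : Ω → Prop} (h : ∀ ω, p ω → q ω ∨ r ω) :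
    unifProb p ≤ unifProb q + unifProb r :=
  (unifProb_mono h).trans (unifProb_or_le q r)

theorem unifProb_add_not [Nonempty Ω] (p : Ω → Prop) :
    unifProb p + unifProb (fun ω => ¬ p ω) = 1 := by
  classical
  unfold unifProb
  rw [← Finset.expect_add_distrib, ← Fintype.expect_one (ι := Ω)]
  refine Finset.expect_congr rfl fun i _ => ?_
  by_cases hp : p i <;> simp [hp]

theorem unifProb_exists_le {ι : Type*} (s : Finset ι) (p : ι → Ω → Prop) :
    unifProb (fun ω => ∃ i ∈ s, p i ω) ≤ ∑ i ∈ s, unifProb (p i) := by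
  classical
  unfold unifProb
  rw [← Finset.expect_sum_comm]
  refine Finset.expect_le_expect fun ω _ => ?_
  split_ifs with h
  · obtain ⟨i, hi, hp⟩ := h
    calc (1 : ℝ) = if p i ω then 1 else 0 := by simp [hp]
      _ ≤ _ := Finset.single_le_sum (f := fun i => if p i ω then (1 : ℝ) else 0)
          (fun j _ => by split_ifs <;> norm_num) hi
  · exact Finset.sum_nonneg fun j _ => by split_ifs <;> norm_num

theorem unifProb_equiv (e : Ω ≃ Ω') (p : Ω' → Prop) :
    unifProb (fun ω => p (e ω)) = unifProb p := by
  classical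
  exact Fintype.expect_equiv e _ _ fun _ => rfl

theorem unifProb_true [Nonempty Ω] {p : Ω → Prop} (h : ∀ ω, p ω) : unifProb p = 1 := by
  simp [unifProb, h]

theorem unifProb_false {p : Ω → Prop} (h : ∀ ω, ¬ p ω) : unifProb p = 0 := by
  simp [unifProb, h]

theorem unifProb_prod (p : Ω → Ω' → Prop) :
    unifProb (fun x : Ω × Ω' => p x.1 x.2) = 𝔼 a, unifProb (p a) := by
  classical
  unfold unifProb
  rw [← Finset.univ_product_univ, Finset.expect_product]

theorem unifProb_prod' (p : Ω → Ω' → Prop) :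
    unifProb (fun x : Ω × Ω' => p x.1 x.2) = 𝔼 b, unifProb (fun a => p a b) := by
  rw [← unifProb_equiv (Equiv.prodComm Ω' Ω)]
  exact unifProb_prod fun b a => p a b

theorem expect_le_of_le {f : Ω → ℝ} {c : ℝ} (hc : 0 ≤ c) (h : ∀ ω, f ω ≤ c) : 𝔼 ω, f ω ≤ c := by
  rcases isEmpty_or_nonempty Ω with hΩ | hΩ
  · simpa using hc
  · exact Finset.expect_le Finset.univ_nonempty fun x _ => h x

/-- If `p a` has probability at most `c` outside the event `q`, then the joint event has
probability at most `P(q) + c`. -/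
theorem unifProb_prod_le_add {q : Ω → Prop} {p : Ω → Ω' → Prop} {c : ℝ} (hc : 0 ≤ c)
    (h : ∀ a, ¬ q a → unifProb (p a) ≤ c) :
    unifProb (fun x : Ω × Ω' => p x.1 x.2) ≤ unifProb q + c := by
  classical
  rw [unifProb_prod]
  calc 𝔼 a, unifProb (p a) ≤ 𝔼 a, ((if q a then (1 : ℝ) else 0) + c) := by
        refine Finset.expect_le_expect fun a _ => ?_
        by_cases hq : q a
        · simp only [hq, if_true]; linarith [unifProb_le_one (p a)]
        · simp only [hq, if_false]; linarith [h a hq]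
    _ = unifProb q + 𝔼 _a : Ω, c := by rw [Finset.expect_add_distrib]; rfl
    _ ≤ _ := by gcongr; exact expect_le_of_le hc fun _ => le_rfl

/-- Markov's inequality. -/
theorem mul_unifProb_le_expect {f : Ω → ℝ} (hf : ∀ ω, 0 ≤ f ω) (t : ℝ) :
    t * unifProb (fun ω => t ≤ f ω) ≤ 𝔼 ω, f ω := by
  classical
  unfold unifProb
  rw [Finset.mul_expect]
  refine Finset.expect_le_expect fun ω _ => ?_
  split_ifs with h
  · simpa using h
  · simpa using hf ω

/-- A uniform point does not change in law when one coordinate is resampled. -/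
theorem expect_update {ι β : Type*} [Fintype ι] [DecidableEq ι] [Fintype β]
    [Nonempty β] (i : ι) (F : (ι → β) → ℝ) :
    𝔼 g, F g = 𝔼 g : ι → β, 𝔼 b, F (Function.update g i b) := by
  classical
  have h1 : 𝔼 x : (ι → β) × β, F (Function.update x.1 i x.2) = 𝔼 x : (ι → β) × β, F x.1 := by
    -- Exchanging the `i`-th coordinate with the fresh value is an involution of the product space.
    let e : (ι → β) × β ≃ (ι → β) × β :=
      { toFun := fun x => (Function.update x.1 i x.2, x.1 i)
        invFun := fun x => (Function.update x.1 i x.2, x.1 i)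
        left_inv := fun x => by simp
        right_inv := fun x => by simp }
    exact Fintype.expect_equiv e _ _ fun _ => rfl
  rw [← Finset.univ_product_univ, Finset.expect_product, Finset.expect_product] at h1
  rw [h1]
  exact Finset.expect_congr rfl fun g _ => (Fintype.expect_const _).symm

theorem unifProb_cons {β : Type*} [Fintype β] {k : ℕ} (p : (Fin (k + 1) → β) → Prop) :
    unifProb p = unifProb (fun x : β × (Fin k → β) => p (Fin.cons x.1 x.2)) :=
  (unifProb_equiv (Fin.consEquiv fun _ => β) p).symm

end UnifProb

/-- The sign `1` or `-1` encoded by a Boolean. -/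
def boolSign (b : Bool) : ℝ := if b then 1 else -1

/-! ### The Littlewood–Offord inequality -/

/-- Squaring makes the bound inductive: the step reduces to (2k + 1)(2k + 3) ≤ 4(k + 1)². -/
theorem centralBinom_div_four_pow_le (k : ℕ) :
    (k.centralBinom : ℝ) / 4 ^ k ≤ 1 / √(2 * k + 1) := by
  have key : (k.centralBinom : ℝ) ^ 2 * (2 * k + 1) ≤ (4 ^ k) ^ 2 := by
    induction k with
    | zero => simp
    | succ k ih =>
      have h : ((k : ℝ) + 1) * (k + 1).centralBinom = 2 * (2 * k + 1) * k.centralBinom := by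
        exact_mod_cast Nat.succ_mul_centralBinom_succ k
      have hk : (0 : ℝ) < (k : ℝ) + 1 := by positivity
      have h2 : ((k : ℝ) + 1) ^ 2 * (((k + 1).centralBinom : ℝ) ^ 2 * (2 * ((k + 1 : ℕ) : ℝ) + 1))
          = 4 * (2 * k + 1) * (2 * k + 3) * ((k.centralBinom : ℝ) ^ 2 * (2 * k + 1)) := by
        have : ((k : ℝ) + 1) ^ 2 * ((k + 1).centralBinom : ℝ) ^ 2
            = (2 * (2 * k + 1) * k.centralBinom) ^ 2 := by rw [← h]; ring
        push_cast
        linear_combination (2 * ((k : ℝ) + 1) + 1) * this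
      have h3 : 4 * (2 * (k : ℝ) + 1) * (2 * k + 3) ≤ 16 * ((k : ℝ) + 1) ^ 2 := by nlinarith
      have h4 : ((k : ℝ) + 1) ^ 2 * (((k + 1).centralBinom : ℝ) ^ 2 * (2 * ((k + 1 : ℕ) : ℝ) + 1))
          ≤ ((k : ℝ) + 1) ^ 2 * (4 ^ (k + 1)) ^ 2 := by
        rw [h2]
        calc _ ≤ 16 * ((k : ℝ) + 1) ^ 2 * (4 ^ k) ^ 2 := by gcongr
          _ = _ := by ring
      exact le_of_mul_le_mul_left h4 (by positivity)
  rw [div_le_div_iff₀ (by positivity) (by positivity), one_mul]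
  refine abs_le_of_sq_le_sq' ?_ (by positivity) |>.2
  rw [mul_pow, Real.sq_sqrt (by positivity)]
  exact key

theorem choose_half_div_two_pow_le {m : ℕ} (hm : 0 < m) :
    (m.choose (m / 2) : ℝ) / 2 ^ m ≤ 1 / √m := by
  rcases Nat.even_or_odd' m with ⟨k, rfl | rfl⟩
  · rw [Nat.mul_div_cancel_left k (by norm_num), ← Nat.centralBinom_eq_two_mul_choose, pow_mul,
      show (2 : ℝ) ^ 2 = 4 by norm_num]
    refine (centralBinom_div_four_pow_le k).trans ?_
    have : (0 : ℝ) < ((2 * k : ℕ) : ℝ) := by exact_mod_cast hm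
    refine one_div_le_one_div_of_le (Real.sqrt_pos.2 this) (Real.sqrt_le_sqrt ?_)
    push_cast; linarith
  · have h1 : (2 * k + 1) / 2 = k := by omega
    have h2 : (k + 1).centralBinom = 2 * (2 * k + 1).choose k := by
      rw [Nat.centralBinom_eq_two_mul_choose, show 2 * (k + 1) = (2 * k + 1) + 1 by ring,
        Nat.choose_succ_succ, Nat.choose_symm_half]
      ring
    have h3 := centralBinom_div_four_pow_le (k + 1)
    rw [h2] at h3
    rw [h1]
    have h4 : (((2 * (2 * k + 1).choose k : ℕ) : ℝ)) / 4 ^ (k + 1)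
        = ((2 * k + 1).choose k : ℝ) / 2 ^ (2 * k + 1) := by
      rw [show (4 : ℝ) ^ (k + 1) = 2 * 2 ^ (2 * k + 1) by
        rw [show (4 : ℝ) = 2 ^ 2 by norm_num, ← pow_mul]; ring]
      push_cast
      rw [mul_div_mul_left _ _ (by norm_num)]
    rw [h4] at h3
    refine h3.trans (one_div_le_one_div_of_le (Real.sqrt_pos.2 (by positivity))
      (Real.sqrt_le_sqrt ?_))
    push_cast; linarith

/-- The Littlewood–Offord inequality: if at least the indices in `I` carry coefficients of
absolute value at least `ρ`, a signed sum lies in a given half-open interval of length `2ρ` with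
probability at most `#I ^ (-1/2)`. -/
theorem unifProb_signed_sum_mem_Ico_le {α : Type*} [Fintype α] [DecidableEq α] (v : α → ℝ)
    (I : Finset α)
    (hI : I.Nonempty) {ρ : ℝ} (hρ : 0 < ρ) (hv : ∀ i ∈ I, ρ ≤ |v i|) (x : ℝ) :
    unifProb (fun a : α → Bool =>
      x ≤ ∑ i, boolSign (a i) * v i ∧ ∑ i, boolSign (a i) * v i < x + 2 * ρ) ≤ 1 / √I.card := by
  classical
  set F : (α → Bool) → ℝ := fun a => ∑ i, boolSign (a i) * v i with hF
  set E : Finset (α → Bool) := Finset.univ.filter fun a => x ≤ F a ∧ F a < x + 2 * ρ with hE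
  let res : (α → Bool) → ({i // i ∉ I} → Bool) := fun a i => a i
  -- The indices of `I` that contribute `+|v i|`. With the signs outside `I` fixed, the sum is
  -- increasing in this set.
  let pos : (α → Bool) → Finset {i // i ∈ I} := fun a =>
    Finset.univ.filter fun i => (a i = true ↔ 0 < v i)
  have hvne : ∀ i ∈ I, v i ≠ 0 := fun i hi h0 => by
    have := hv i hi; rw [h0, abs_zero] at this; linarith
  have hterm : ∀ (a : α → Bool) (i : {i // i ∈ I}),
      boolSign (a i) * v i = if i ∈ pos a then |v i| else -|v i| := by
    intro a i
    rcases lt_or_gt_of_ne (hvne i i.2) with h | h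
    · rw [abs_of_neg h]
      cases hai : a i <;> simp [pos, boolSign, hai, h.not_gt]
    · rw [abs_of_pos h]
      cases hai : a i <;> simp [pos, boolSign, hai, h]
  have hsplit : ∀ a, F a = ∑ i : {i // i ∈ I}, (if i ∈ pos a then |v i| else -|v i|)
      + ∑ i : {i // i ∉ I}, boolSign (res a i) * v i := by
    intro a
    rw [hF]
    simp only [← hterm]
    convert (Fintype.sum_subtype_add_sum_subtype (fun i => i ∈ I)
      (fun i => boolSign (a i) * v i)).symm
  have hinj : ∀ a b, res a = res b → pos a = pos b → a = b := by
    intro a b h1 h2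
    funext i
    by_cases hi : i ∈ I
    · have : (⟨i, hi⟩ : {i // i ∈ I}) ∈ pos a ↔ (⟨i, hi⟩ : {i // i ∈ I}) ∈ pos b := by rw [h2]
      simp only [pos, Finset.mem_filter, Finset.mem_univ, true_and] at this
      have h3 : (a i = true ↔ b i = true) := by tauto
      exact Bool.eq_iff_iff.2 h3
    · exact congrFun h1 ⟨i, hi⟩
  have hfib : ∀ y ∈ E.image res, (E.filter fun a => res a = y).card ≤
      I.card.choose (I.card / 2) := by
    intro y _
    -- Erdős's argument: a strict inclusion raises the sum by at least 2ρ, too much for a half-open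
    -- interval of that length. Sperner's theorem then bounds each fibre.
    have hanti : IsAntichain (· ⊆ ·)
        (((E.filter fun a => res a = y).image pos : Finset (Finset {i // i ∈ I})) :
          Set (Finset {i // i ∈ I})) := by
      intro A hA B hB hne hAB
      simp only [Finset.coe_image, Set.mem_image, Finset.mem_coe, Finset.mem_filter] at hA hB
      obtain ⟨a, ⟨haE, hay⟩, rfl⟩ := hA
      obtain ⟨b, ⟨hbE, hby⟩, rfl⟩ := hB
      obtain ⟨i, hib, hia⟩ := Finset.exists_of_ssubset (hAB.ssubset_of_ne hne)
      have h1 : F b - F a = ∑ i : {i // i ∈ I}, ((if i ∈ pos b then |v i| else -|v i|)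
          - (if i ∈ pos a then |v i| else -|v i|)) := by
        rw [hsplit a, hsplit b, hay, hby, Finset.sum_sub_distrib]; ring
      have h2 : 2 * ρ ≤ F b - F a := by
        rw [h1]
        calc 2 * ρ ≤ (if i ∈ pos b then |v i| else -|v i|)
              - (if i ∈ pos a then |v i| else -|v i|) := by
              rw [if_pos hib, if_neg hia]; linarith [hv i i.2]
          _ ≤ _ := Finset.single_le_sum
              (f := fun i : {i // i ∈ I} => (if i ∈ pos b then |v i| else -|v i|)
                - (if i ∈ pos a then |v i| else -|v i|)) (fun j _ => ?_) (Finset.mem_univ i)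
        have := abs_nonneg (v j)
        by_cases hj : j ∈ pos a
        · simp [hj, hAB hj]
        · simp only [hj, if_false]; split_ifs <;> linarith
      simp only [hE, Finset.mem_filter, Finset.mem_univ, true_and] at haE hbE
      linarith [haE.1, hbE.2]
    have hcard := hanti.sperner
    rw [Finset.card_image_of_injOn] at hcard
    · simpa using hcard
    · intro a ha b hb hab
      simp only [Finset.mem_coe, Finset.mem_filter] at ha hb
      exact hinj a b (ha.2.trans hb.2.symm) hab
  have hE1 : E.card ≤ I.card.choose (I.card / 2) * 2 ^ (Fintype.card α - I.card) := by
    refine (Finset.card_le_mul_card_image E _ hfib).trans (Nat.mul_le_mul_left _ ?_)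
    refine (Finset.card_le_univ _).trans ?_
    simp [Fintype.card_subtype_compl]
  have hIα : I.card ≤ Fintype.card α := Finset.card_le_univ _
  rw [unifProb_eq_card_div]
  refine le_trans ?_ (choose_half_div_two_pow_le hI.card_pos)
  rw [div_le_div_iff₀ (by simp) (by positivity)]
  have h5 : (Fintype.card (α → Bool) : ℝ) = 2 ^ (Fintype.card α - I.card) * 2 ^ I.card := by
    rw [← pow_add, Nat.sub_add_cancel hIα]; simp
  rw [h5, ← mul_assoc]
  gcongr
  exact_mod_cast hE1

theorem unifProb_abs_signed_sum_lt_le {α : Type*} [Fintype α] [DecidableEq α] (v : α → ℝ)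
    (I : Finset α)
    (hI : I.Nonempty) {ρ : ℝ} (hρ : 0 < ρ) (hv : ∀ i ∈ I, ρ ≤ |v i|) :
    unifProb (fun a : α → Bool => |∑ i, boolSign (a i) * v i| < ρ) ≤ 1 / √I.card := by
  refine (unifProb_mono fun a ha => ?_).trans
    (unifProb_signed_sum_mem_Ico_le v I hI hρ hv (-ρ))
  rw [abs_lt] at ha
  exact ⟨ha.1.le, by linarith⟩

/-- The interval [-T, T] is covered by ⌊T/ρ⌋ + 1 half-open intervals of length 2ρ. -/
theorem unifProb_abs_signed_sum_le_le {α : Type*} [Fintype α] [DecidableEq α] (v : α → ℝ)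
    (I : Finset α)
    (hI : I.Nonempty) {ρ : ℝ} (hρ : 0 < ρ) (hv : ∀ i ∈ I, ρ ≤ |v i|) {T : ℝ} (hT : 0 ≤ T) :
    unifProb (fun a : α → Bool => |∑ i, boolSign (a i) * v i| ≤ T) ≤ (T / ρ + 1) / √I.card := by
  classical
  set k := ⌊T / ρ⌋₊ + 1 with hk
  have hkT : (k : ℝ) ≤ T / ρ + 1 := by
    rw [hk]; push_cast; gcongr; exact Nat.floor_le (by positivity)
  have hlt : T / ρ < k := by rw [hk]; push_cast; exact Nat.lt_floor_add_one _
  calc unifProb (fun a : α → Bool => |∑ i, boolSign (a i) * v i| ≤ T)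
      ≤ unifProb (fun a : α → Bool => ∃ j ∈ Finset.range k,
          (-T + 2 * ρ * j) ≤ ∑ i, boolSign (a i) * v i ∧
          ∑ i, boolSign (a i) * v i < (-T + 2 * ρ * j) + 2 * ρ) := by
        refine unifProb_mono fun a ha => ?_
        set y := ∑ i, boolSign (a i) * v i
        rw [abs_le] at ha
        have h0 : 0 ≤ (y + T) / (2 * ρ) := div_nonneg (by linarith) (by positivity)
        have h1 := Nat.floor_le h0
        have h2 := Nat.lt_floor_add_one ((y + T) / (2 * ρ))
        rw [le_div_iff₀ (by positivity)] at h1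
        rw [div_lt_iff₀ (by positivity)] at h2
        refine ⟨⌊(y + T) / (2 * ρ)⌋₊, Finset.mem_range.2 ?_, by linarith, by linarith⟩
        have h3 : (y + T) / (2 * ρ) < k := by
          refine lt_of_le_of_lt ?_ hlt
          rw [div_le_div_iff₀ (by positivity) hρ]
          nlinarith [ha.2]
        exact (Nat.floor_lt h0).2 h3
    _ ≤ ∑ j ∈ Finset.range k, 1 / √I.card :=
        (unifProb_exists_le _ _).trans (Finset.sum_le_sum fun j _ =>
          unifProb_signed_sum_mem_Ico_le v I hI hρ hv _)
    _ = k / √I.card := by simp [div_eq_mul_inv]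
    _ ≤ _ := by gcongr

/-! ### Moments of signed sums -/

theorem expect_bool (f : Bool → ℝ) : 𝔼 b, f b = (f true + f false) / 2 := by
  rw [Fintype.expect_eq_sum_div_card]; simp

theorem sum_update_of_notMem {β γ : Type*} [DecidableEq β] (x : β → ℝ) (h : γ → ℝ)
    {s : Finset β} {b : β}
    (hb : b ∉ s) (g : β → γ) (u : γ) :
    ∑ j ∈ s, h (Function.update g b u j) * x j = ∑ j ∈ s, h (g j) * x j := by
  refine Finset.sum_congr rfl fun j hj => ?_
  rw [Function.update_of_ne (ne_of_mem_of_not_mem hj hb)]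

section Moments
variable {β : Type*} [Fintype β] [DecidableEq β]

theorem expect_signed_sum_sq_finset (x : β → ℝ) (s : Finset β) :
    𝔼 g : β → Bool, (∑ b ∈ s, boolSign (g b) * x b) ^ 2 = ∑ b ∈ s, x b ^ 2 := by
  induction s using Finset.induction_on with
  | empty => simp
  | insert b s hb ih =>
    rw [expect_update b]
    simp only [Finset.sum_insert hb, Function.update_self, sum_update_of_notMem x boolSign hb,
      expect_bool]
    rw [← ih, ← Fintype.expect_const (ι := β → Bool) (x b ^ 2), ← Finset.expect_add_distrib]
    exact Finset.expect_congr rfl fun g _ => by simp [boolSign]; ring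

/-- Averaging over one new sign kills the odd powers, so S⁴ becomes S⁴ + 6x²S² + x⁴; the constant 3
makes the cross terms match. -/
theorem expect_signed_sum_pow_four_finset (x : β → ℝ) (s : Finset β) :
    𝔼 g : β → Bool, (∑ b ∈ s, boolSign (g b) * x b) ^ 4 ≤ 3 * (∑ b ∈ s, x b ^ 2) ^ 2 := by
  induction s using Finset.induction_on with
  | empty => simp
  | insert b s hb ih =>
    have h2 := expect_signed_sum_sq_finset x s
    have h4 : 𝔼 g : β → Bool, (∑ j ∈ insert b s, boolSign (g j) * x j) ^ 4
        = 𝔼 g : β → Bool, (∑ j ∈ s, boolSign (g j) * x j) ^ 4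
          + 6 * x b ^ 2 * 𝔼 g : β → Bool, (∑ j ∈ s, boolSign (g j) * x j) ^ 2 + x b ^ 4 := by
      rw [expect_update b, ← Fintype.expect_const (ι := β → Bool) (x b ^ 4), Finset.mul_expect,
        ← Finset.expect_add_distrib, ← Finset.expect_add_distrib]
      refine Finset.expect_congr rfl fun g _ => ?_
      simp only [Finset.sum_insert hb, Function.update_self, sum_update_of_notMem x boolSign hb,
        expect_bool]
      simp only [boolSign, if_true, Bool.false_eq_true, if_false]
      ring
    rw [h4, h2, Finset.sum_insert hb]
    nlinarith [sq_nonneg (x b ^ 2)]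

theorem expect_signed_sum_sq (x : β → ℝ) :
    𝔼 g : β → Bool, (∑ b, boolSign (g b) * x b) ^ 2 = ∑ b, x b ^ 2 :=
  expect_signed_sum_sq_finset x _

theorem expect_signed_sum_pow_four (x : β → ℝ) :
    𝔼 g : β → Bool, (∑ b, boolSign (g b) * x b) ^ 4 ≤ 3 * (∑ b, x b ^ 2) ^ 2 :=
  expect_signed_sum_pow_four_finset x _

/-- A signed sum exceeds half of its standard deviation with probability at least `1 / 12`. -/
theorem le_unifProb_le_abs_signed_sum (x : β → ℝ) {ρ : ℝ} (hρ : 0 < ρ)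
    (hx : ρ ^ 2 ≤ ∑ b, x b ^ 2) :
    1 / 12 ≤ unifProb (fun g : β → Bool => ρ / 2 ≤ |∑ b, boolSign (g b) * x b|) := by
  classical
  set V := ∑ b, x b ^ 2 with hV
  have hV0 : 0 < V := lt_of_lt_of_le (by positivity) hx
  -- Paley–Zygmund in linear form: pointwise y² ≤ V/2 + y⁴/(12V) + 3V·1_{|y| ≥ ρ/2}. The fourth
  -- moment contributes at most V/4, so the event has probability at least (V/4)/(3V).
  have h : V ≤ 𝔼 g : β → Bool, (V / 2 + 1 / (12 * V) * (∑ b, boolSign (g b) * x b) ^ 4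
      + 3 * V * (if ρ / 2 ≤ |∑ b, boolSign (g b) * x b| then (1 : ℝ) else 0)) := by
    rw [hV, ← expect_signed_sum_sq x]
    refine Finset.expect_le_expect fun g _ => ?_
    rw [expect_signed_sum_sq x, ← hV]
    set y := ∑ b, boolSign (g b) * x b
    have hy4 : 0 ≤ 1 / (12 * V) * y ^ 4 := by positivity
    split_ifs with hc
    · have : 1 / (12 * V) * y ^ 4 + 3 * V - y ^ 2 = (y ^ 2 - 6 * V) ^ 2 / (12 * V) := by
        field_simp; ring
      have h0 : 0 ≤ (y ^ 2 - 6 * V) ^ 2 / (12 * V) := by positivity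
      linarith
    · push Not at hc
      have : y ^ 2 ≤ (ρ / 2) ^ 2 :=
        sq_le_sq' (by linarith [neg_abs_le y]) (by linarith [le_abs_self y])
      nlinarith
  rw [Finset.expect_add_distrib, Finset.expect_add_distrib, Fintype.expect_const,
    ← Finset.mul_expect, ← Finset.mul_expect] at h
  have h4 := expect_signed_sum_pow_four x
  rw [← hV] at h4
  have h5 : 1 / (12 * V) * 𝔼 g : β → Bool, (∑ b, boolSign (g b) * x b) ^ 4 ≤ V / 4 := by
    calc _ ≤ 1 / (12 * V) * (3 * V ^ 2) := by gcongr
      _ = V / 4 := by field_simp; norm_num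
  change _ ≤ _ + _ + 3 * V * unifProb _ at h
  by_contra hlt
  push Not at hlt
  nlinarith

end Moments

/-- Dimension-free Littlewood–Offord inequality: a signed sum of vectors, those in `I` of norm at
least `ρ`, is unlikely to have norm at most `R`. -/
theorem unifProb_norm_sq_signed_sum_le_le {α β : Type*} [Fintype α] [DecidableEq α] [Fintype β]
    (q : α → β → ℝ) (I : Finset α) (hI : I.Nonempty) {ρ R : ℝ} (hρ : 0 < ρ) (hR : 0 < R)
    (hq : ∀ i ∈ I, ρ ^ 2 ≤ ∑ b, q i b ^ 2) :
    unifProb (fun a : α → Bool => ∑ b, (∑ i, boolSign (a i) * q i b) ^ 2 ≤ R ^ 2)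
      ≤ 40 * ((8 * R / (ρ / 2) + 1) / √(I.card / 24)) := by
  classical
  have hI0 : (0 : ℝ) < I.card := by exact_mod_cast hI.card_pos
  -- Projection onto a random sign direction `g` reduces the vector statement to the scalar one. `G`
  -- says that a positive fraction of the vectors in `I` keep a large projection.
  set v : (β → Bool) → α → ℝ := fun g i => ∑ b, boolSign (g b) * q i b with hv
  set V : (α → Bool) → β → ℝ := fun a b => ∑ i, boolSign (a i) * q i b with hV
  set G : (β → Bool) → Prop := fun g =>
    (I.card : ℝ) / 24 ≤ (I.filter fun i => ρ / 2 ≤ |v g i|).card with hG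
  have hswap : ∀ a g, ∑ b, boolSign (g b) * V a b = ∑ i, boolSign (a i) * v g i := by
    intro a g
    simp only [hv, hV, Finset.mul_sum]
    rw [Finset.sum_comm]
    exact Finset.sum_congr rfl fun i _ => Finset.sum_congr rfl fun b _ => by ring
  -- The count has mean at least #I/12 and never exceeds #I, so it is at least half of #I/12 with
  -- probability at least 1/24.
  have hPG : 1 / 24 ≤ unifProb G := by
    have h1 : (I.card : ℝ) / 12 ≤ 𝔼 g : β → Bool,
        ((I.filter fun i => ρ / 2 ≤ |v g i|).card : ℝ) := by
      calc (I.card : ℝ) / 12 = ∑ i ∈ I, (1 / 12 : ℝ) := by simp; ring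
        _ ≤ ∑ i ∈ I, unifProb (fun g => ρ / 2 ≤ |v g i|) :=
            Finset.sum_le_sum fun i hi => le_unifProb_le_abs_signed_sum (q i) hρ (hq i hi)
        _ = _ := by
            unfold unifProb
            rw [← Finset.expect_sum_comm]
            refine Finset.expect_congr rfl fun g _ => ?_
            rw [Finset.sum_boole]
    have h2 : 𝔼 g : β → Bool, ((I.filter fun i => ρ / 2 ≤ |v g i|).card : ℝ)
        ≤ 𝔼 g : β → Bool, ((I.card : ℝ) / 24 + I.card * (if G g then (1 : ℝ) else 0)) := by
      refine Finset.expect_le_expect fun g _ => ?_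
      have h3 : ((I.filter fun i => ρ / 2 ≤ |v g i|).card : ℝ) ≤ I.card := by
        exact_mod_cast Finset.card_filter_le _ _
      split_ifs with hc
      · linarith
      · simp only [hG, not_le] at hc; linarith
    rw [Finset.expect_add_distrib, Fintype.expect_const, ← Finset.mul_expect] at h2
    change _ ≤ _ + _ * unifProb G at h2
    have h3 := h1.trans h2
    by_contra hlt
    push Not at hlt
    nlinarith
  set J := unifProb (fun x : (α → Bool) × (β → Bool) =>
    G x.2 ∧ |∑ i, boolSign (x.1 i) * v x.2 i| ≤ 8 * R) with hJ
  -- A vector of norm at most R has projection at least 8R with probability at most 1/64, by the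
  -- second moment, and 1/24 - 1/64 > 1/40.
  have hlow : (1 / 40) * unifProb (fun a : α → Bool => ∑ b, V a b ^ 2 ≤ R ^ 2) ≤ J := by
    rw [hJ, unifProb_prod
      (fun (a : α → Bool) (g : β → Bool) => G g ∧ |∑ i, boolSign (a i) * v g i| ≤ 8 * R)]
    unfold unifProb
    rw [Finset.mul_expect]
    refine Finset.expect_le_expect fun a _ => ?_
    split_ifs with ha
    · have h1 : unifProb G ≤ unifProb (fun g => G g ∧ |∑ i, boolSign (a i) * v g i| ≤ 8 * R)
          + unifProb (fun g : β → Bool => 64 * R ^ 2 ≤ (∑ b, boolSign (g b) * V a b) ^ 2) := by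
        refine unifProb_le_add fun g hg => ?_
        by_cases hc : |∑ i, boolSign (a i) * v g i| ≤ 8 * R
        · exact Or.inl ⟨hg, hc⟩
        · right
          push Not at hc
          rw [hswap, ← sq_abs (∑ i, boolSign (a i) * v g i)]
          nlinarith
      have h2 := mul_unifProb_le_expect
        (f := fun g : β → Bool => (∑ b, boolSign (g b) * V a b) ^ 2) (fun _ => sq_nonneg _)
        (64 * R ^ 2)
      rw [expect_signed_sum_sq] at h2
      have h3 : unifProb (fun g : β → Bool => 64 * R ^ 2 ≤ (∑ b, boolSign (g b) * V a b) ^ 2)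
          ≤ 1 / 64 := by
        have hR2 : 0 < R ^ 2 := by positivity
        by_contra hlt
        push Not at hlt
        nlinarith
      have h4 : unifProb (fun g => G g ∧ |∑ i, boolSign (a i) * v g i| ≤ 8 * R) ≥ 1 / 40 := by
        linarith
      simpa [unifProb] using h4
    · simpa [unifProb] using unifProb_nonneg (fun g => G g ∧ |∑ i, boolSign (a i) * v g i| ≤ 8 * R)
  have hup : J ≤ (8 * R / (ρ / 2) + 1) / √(I.card / 24) := by
    rw [hJ, unifProb_prod'
      (fun (a : α → Bool) (g : β → Bool) => G g ∧ |∑ i, boolSign (a i) * v g i| ≤ 8 * R)]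
    refine expect_le_of_le (by positivity) fun g => ?_
    by_cases hg : G g
    · have hpos : 0 < (I.filter fun i => ρ / 2 ≤ |v g i|).card := by
        have : (0 : ℝ) < (I.filter fun i => ρ / 2 ≤ |v g i|).card :=
          lt_of_lt_of_le (by positivity) hg
        exact_mod_cast this
      refine (unifProb_mono fun a ha => ha.2).trans
        ((unifProb_abs_signed_sum_le_le (v g) _ (Finset.card_pos.1 hpos) (half_pos hρ)
          (fun i hi => (Finset.mem_filter.1 hi).2) (by positivity : 0 ≤ 8 * R)).trans ?_)
      gcongr
    · rw [unifProb_false fun a ha => hg ha.1]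
      positivity
  linarith

/-! ### Laplace expansion along rows of signs -/

/-- The sum of the squares of the values of a set function. -/
def energy {α : Type*} [Fintype α] (f : Finset α → ℝ) : ℝ := ∑ A, f A ^ 2

theorem energy_nonneg {α : Type*} [Fintype α] (f : Finset α → ℝ) : 0 ≤ energy f :=
  Finset.sum_nonneg fun _ _ => sq_nonneg _

section RowStep
variable {α : Type*} [DecidableEq α]

/-- If `f B` is the permanent of some rows restricted to the columns `B`, then `rowStep a f B` is
the permanent obtained by adding the row of signs `a`. -/
def rowStep (a : α → Bool) (f : Finset α → ℝ) (B : Finset α) : ℝ :=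
  ∑ j ∈ B, boolSign (a j) * f (B.erase j)

/-- Successive addition of the rows in a list, the head of the list being added last. -/
def rowSteps (l : List (α → Bool)) (f : Finset α → ℝ) : Finset α → ℝ := l.foldr rowStep f

@[simp] theorem rowSteps_nil (f : Finset α → ℝ) : rowSteps [] f = f := rfl

@[simp] theorem rowSteps_cons (a : α → Bool) (l : List (α → Bool)) (f : Finset α → ℝ) :
    rowSteps (a :: l) f = rowStep a (rowSteps l f) := rfl

theorem rowSteps_append (l l' : List (α → Bool)) (f : Finset α → ℝ) :
    rowSteps (l ++ l') f = rowSteps l (rowSteps l' f) := by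
  simp [rowSteps]

/-- The set function `f` vanishes except at sets of cardinality `k`. -/
def SupportedOnCard (f : Finset α → ℝ) (k : ℕ) : Prop := ∀ A, f A ≠ 0 → A.card = k

theorem SupportedOnCard.rowStep {f : Finset α → ℝ} {k : ℕ} (hf : SupportedOnCard f k)
    (a : α → Bool) : SupportedOnCard (rowStep a f) (k + 1) := by
  intro B hB
  obtain ⟨j, hj, hne⟩ := Finset.exists_ne_zero_of_sum_ne_zero hB
  have := hf _ (right_ne_zero_of_mul hne)
  rw [← this, Finset.card_erase_add_one hj]

theorem SupportedOnCard.rowSteps {f : Finset α → ℝ} {k : ℕ} (hf : SupportedOnCard f k)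
    (l : List (α → Bool)) : SupportedOnCard (rowSteps l f) (k + l.length) := by
  induction l with
  | nil => exact hf
  | cons a l ih => exact ih.rowStep a

theorem rowStep_insert {a : α → Bool} {f : Finset α → ℝ} {A : Finset α} {i : α} (hi : i ∉ A) :
    rowStep a f (insert i A) =
      boolSign (a i) * f A + ∑ j ∈ A, boolSign (a j) * f ((insert i A).erase j) := by
  rw [rowStep, Finset.sum_insert hi, Finset.erase_insert hi]

variable [Fintype α]

/-- It is exponentially unlikely that every extension `insert i A` of `A` has a smaller value. -/
theorem unifProb_forall_abs_rowStep_insert_lt_le (f : Finset α → ℝ) (A : Finset α) :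
    unifProb (fun a : α → Bool => ∀ i ∉ A, |rowStep a f (insert i A)| < |f A|)
      ≤ (1 / 2) ^ (Fintype.card α - A.card) := by
  classical
  have hA : A.card ≤ Fintype.card α := Finset.card_le_univ _
  rw [unifProb_eq_card_div]
  -- Once the signs on `A` are fixed, the two choices of `a i` give values differing by 2|f A|, so
  -- at most one lies in the open interval (-|f A|, |f A|). A bad row is therefore determined by its
  -- restriction to `A`.
  have hcard : (Finset.univ.filter fun a : α → Bool =>
      ∀ i ∉ A, |rowStep a f (insert i A)| < |f A|).card ≤ 2 ^ A.card := by
    have : Fintype.card ({i // i ∈ A} → Bool) = 2 ^ A.card := by simp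
    rw [← this, ← Finset.card_univ]
    refine Finset.card_le_card_of_injOn (fun a i => a i)
      (fun _ _ => Finset.mem_coe.2 (Finset.mem_univ _)) ?_
    intro a ha b hb hab
    simp only [Finset.coe_filter, Finset.mem_univ, true_and] at ha hb
    funext i
    by_cases hi : i ∈ A
    · exact congrFun hab ⟨i, hi⟩
    · by_contra hne
      have h1 := ha i hi
      have h2 := hb i hi
      rw [rowStep_insert hi] at h1 h2
      have h3 : ∑ j ∈ A, boolSign (a j) * f ((insert i A).erase j)
          = ∑ j ∈ A, boolSign (b j) * f ((insert i A).erase j) :=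
        Finset.sum_congr rfl fun j hj => by rw [show a j = b j from congrFun hab ⟨j, hj⟩]
      rw [h3] at h1
      set s := ∑ j ∈ A, boolSign (b j) * f ((insert i A).erase j)
      rw [abs_lt] at h1 h2
      rcases hai : a i <;> rcases hbi : b i <;> simp only [hai, hbi, not_true] at hne
      all_goals
        simp only [hai, hbi, boolSign, if_true, Bool.false_eq_true, if_false] at h1 h2
        rcases abs_cases (f A) with ⟨h, _⟩ | ⟨h, _⟩ <;> rw [h] at h1 h2 <;>
          linarith [h1.1, h1.2, h2.1, h2.2]
  have h2 : (Fintype.card (α → Bool) : ℝ) = 2 ^ A.card * 2 ^ (Fintype.card α - A.card) := by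
    rw [← pow_add, Nat.add_sub_cancel' hA]; simp
  rw [h2, one_div, inv_pow, div_le_iff₀ (by positivity), mul_comm (2 ^ A.card : ℝ),
    inv_mul_cancel_left₀ (by positivity)]
  exact_mod_cast hcard

/-- A new row rarely makes the energy drop. -/
theorem unifProb_energy_rowStep_lt_le {f : Finset α → ℝ} {k : ℕ} (hf : SupportedOnCard f k)
    (hk : k < Fintype.card α) :
    unifProb (fun a => energy (rowStep a f) < energy f / (4 * Fintype.card α))
      ≤ 4 / 3 * (1 / 2) ^ (Fintype.card α - k) := by
  classical
  set N := Fintype.card α with hN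
  have hN0 : (0 : ℝ) < N := by exact_mod_cast (by omega : 0 < N)
  rcases (energy_nonneg f).eq_or_lt with h0 | h0
  · rw [unifProb_false]
    · positivity
    · intro a
      rw [← h0, zero_div, not_lt]
      exact energy_nonneg _
  set Bad : (α → Bool) → Finset α → Prop := fun a A =>
    ∀ i ∉ A, |rowStep a f (insert i A)| < |f A| with hBad
  set W : (α → Bool) → ℝ := fun a => ∑ A, f A ^ 2 * (if Bad a A then 1 else 0) with hW
  have hW0 : ∀ a, 0 ≤ W a := fun a => Finset.sum_nonneg fun A _ =>
    mul_nonneg (sq_nonneg _) (by split_ifs <;> norm_num)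
  have hEW : 𝔼 a, W a ≤ (1 / 2) ^ (N - k) * energy f := by
    rw [hW, Finset.expect_sum_comm, energy, Finset.mul_sum]
    refine Finset.sum_le_sum fun A _ => ?_
    rw [← Finset.mul_expect, mul_comm]
    by_cases hA : f A = 0
    · simp [hA]
    · have := unifProb_forall_abs_rowStep_insert_lt_le f A
      rw [hf A hA] at this
      refine mul_le_mul_of_nonneg_right (le_trans (le_of_eq ?_) this) (sq_nonneg _)
      unfold unifProb
      exact Finset.expect_congr rfl fun a _ => by congr
  have hmain : ∀ a, energy (rowStep a f) < energy f / (4 * N) → 3 / 4 * energy f ≤ W a := by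
    intro a ha
    by_contra hlt
    push Not at hlt
    -- Each `A` that is not bad is charged to an extension of at least the same size.
    have h1 : energy f - W a ≤ ∑ A, ∑ i, (if i ∉ A then rowStep a f (insert i A) ^ 2 else 0) := by
      rw [energy, hW, ← Finset.sum_sub_distrib]
      refine Finset.sum_le_sum fun A _ => ?_
      have hnn : ∀ i ∈ Finset.univ,
          0 ≤ (if i ∉ A then rowStep a f (insert i A) ^ 2 else 0) := fun i _ => by
        split_ifs
        · exact le_rfl
        · exact sq_nonneg _
      by_cases hb : Bad a A
      · simp only [hb, if_true, mul_one, sub_self]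
        exact Finset.sum_nonneg hnn
      · simp only [hb, if_false, mul_zero, sub_zero]
        simp only [hBad] at hb
        push Not at hb
        obtain ⟨i, hi, hle⟩ := hb
        calc f A ^ 2 ≤ rowStep a f (insert i A) ^ 2 := sq_le_sq.2 hle
          _ = (if i ∉ A then rowStep a f (insert i A) ^ 2 else 0) := by simp [hi]
          _ ≤ _ := Finset.single_le_sum hnn (Finset.mem_univ i)
    -- For fixed `i` the map `A ↦ insert i A` is injective, so the double charge is at most N times
    -- the new energy.
    have h2 : ∑ A, ∑ i, (if i ∉ A then rowStep a f (insert i A) ^ 2 else 0)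
        ≤ N * energy (rowStep a f) := by
      rw [Finset.sum_comm]
      calc _ ≤ ∑ _i : α, energy (rowStep a f) := by
            refine Finset.sum_le_sum fun i _ => ?_
            rw [← Finset.sum_filter, energy]
            rw [← Finset.sum_image (f := fun B => rowStep a f B ^ 2)
              (g := fun A : Finset α => insert i A)]
            · exact Finset.sum_le_univ_sum_of_nonneg fun _ => sq_nonneg _
            · intro A hA B hB hAB
              simp only [Finset.coe_filter, Finset.mem_univ, true_and] at hA hB
              rw [← Finset.erase_insert hA, ← Finset.erase_insert hB]
              exact congrArg (fun s => s.erase i) hAB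
        _ = _ := by simp [hN]
    rw [lt_div_iff₀ (by positivity)] at ha
    linarith
  have hmk := mul_unifProb_le_expect hW0 (3 / 4 * energy f)
  have h3 := unifProb_mono hmain
  have h4 : 3 / 4 * energy f * unifProb (fun a => energy (rowStep a f) < energy f / (4 * N))
      ≤ (1 / 2) ^ (N - k) * energy f :=
    (mul_le_mul_of_nonneg_left h3 (by positivity)).trans (hmk.trans hEW)
  have h5 : energy f * (3 / 4 * unifProb (fun a => energy (rowStep a f) < energy f / (4 * N)))
      ≤ energy f * (1 / 2) ^ (N - k) := by linarith
  have h6 := le_of_mul_le_mul_left h5 h0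
  linarith

/-- As long as linearly many rows are missing, a new row typically multiplies the energy by a
factor `G` that may be nearly as large as the number of missing rows. -/
theorem unifProb_energy_rowStep_lt_mul_le {f : Finset α → ℝ} {k : ℕ} (hf : SupportedOnCard f k)
    (hk : k < Fintype.card α) {G : ℝ} (hG : 0 < G) :
    unifProb (fun a => energy (rowStep a f) < G * energy f)
      ≤ 40 * ((16 * √(2 * Fintype.card α * G / (Fintype.card α - k : ℕ)) + 1)
          / √((Fintype.card α - k : ℕ) / 48)) := by
  classical
  set N := Fintype.card α with hN
  set d := N - k with hd
  have hN0 : (0 : ℝ) < N := by exact_mod_cast (by omega : 0 < N)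
  have hd0 : (0 : ℝ) < d := by exact_mod_cast (by omega : 0 < d)
  rcases (energy_nonneg f).eq_or_lt with h0 | h0
  · rw [unifProb_false]
    · positivity
    · intro a
      rw [← h0, mul_zero, not_lt]
      exact energy_nonneg _
  -- The new vector of minors is the signed sum of the vectors `q i`, to which the dimension-free
  -- inequality applies.
  set q : α → Finset α → ℝ := fun i B => if i ∈ B then f (B.erase i) else 0 with hq
  have hstep : ∀ a B, rowStep a f B = ∑ i, boolSign (a i) * q i B := by
    intro a B
    simp only [hq, mul_ite, mul_zero, ← Finset.sum_filter]
    simp [rowStep]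
  have hqn : ∀ i, ∑ B, q i B ^ 2 = ∑ A, if i ∉ A then f A ^ 2 else 0 := by
    intro i
    simp only [hq, ite_pow, ne_eq, OfNat.ofNat_ne_zero, not_false_eq_true, zero_pow,
      ← Finset.sum_filter]
    refine Finset.sum_bij' (fun B _ => B.erase i) (fun A _ => insert i A) ?_ ?_ ?_ ?_ ?_
    · intro B _; simp
    · intro A _; simp
    · intro B hB; exact Finset.insert_erase (Finset.mem_filter.1 hB).2
    · intro A hA; exact Finset.erase_insert (Finset.mem_filter.1 hA).2
    · intro B _; rfl
  have hqle : ∀ i, ∑ B, q i B ^ 2 ≤ energy f := by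
    intro i
    rw [hqn]
    exact Finset.sum_le_sum fun A _ => by split_ifs <;> [exact sq_nonneg _; exact le_rfl]
  -- Each `A` in the support is counted once for every `i ∉ A`, that is `d` times. As no `q i`
  -- exceeds the energy, at least d/2 of them carry at least half of the average.
  have htot : ∑ i, ∑ B, q i B ^ 2 = d * energy f := by
    simp only [hqn]
    rw [Finset.sum_comm, energy, Finset.mul_sum]
    refine Finset.sum_congr rfl fun A _ => ?_
    rw [← Finset.sum_filter, Finset.sum_const, nsmul_eq_mul]
    by_cases hA : f A = 0
    · simp [hA]
    · congr 2
      rw [hd, ← hf A hA, hN, ← Finset.card_compl]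
      congr 1; ext; simp
  set I := Finset.univ.filter fun i => (d : ℝ) / (2 * N) * energy f ≤ ∑ B, q i B ^ 2 with hI
  have hIc : (d : ℝ) / 2 ≤ I.card := by
    have h1 : ∑ i, ∑ B, q i B ^ 2
        ≤ ∑ i, ((if i ∈ I then energy f else 0) + (d : ℝ) / (2 * N) * energy f) := by
      refine Finset.sum_le_sum fun i _ => ?_
      split_ifs with h
      · have : 0 ≤ (d : ℝ) / (2 * N) * energy f := by positivity
        linarith [hqle i]
      · simp only [hI, Finset.mem_filter, Finset.mem_univ, true_and, not_le] at h
        linarith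
    rw [htot, Finset.sum_add_distrib, Finset.sum_const, Finset.card_univ, ← hN, nsmul_eq_mul,
      Finset.sum_ite_mem, Finset.univ_inter, Finset.sum_const, nsmul_eq_mul] at h1
    have h2 : (N : ℝ) * (d / (2 * N) * energy f) = d / 2 * energy f := by field_simp
    rw [h2] at h1
    have h3 : (d : ℝ) / 2 * energy f ≤ I.card * energy f := by linarith
    exact le_of_mul_le_mul_right h3 h0
  have hIne : I.Nonempty := by
    rw [← Finset.card_pos]
    have : (0 : ℝ) < I.card := lt_of_lt_of_le (by positivity) hIc
    exact_mod_cast this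
  have hρ : 0 < √((d : ℝ) / (2 * N) * energy f) := Real.sqrt_pos.2 (by positivity)
  have hR : 0 < √(G * energy f) := Real.sqrt_pos.2 (by positivity)
  have key := unifProb_norm_sq_signed_sum_le_le q I hIne hρ hR (fun i hi => by
    rw [Real.sq_sqrt (by positivity)]; exact (Finset.mem_filter.1 hi).2)
  rw [Real.sq_sqrt (by positivity)] at key
  refine (unifProb_mono fun a ha => ?_).trans (key.trans ?_)
  · simp only [energy, hstep] at ha ⊢
    exact ha.le
  · have h1 : 8 * √(G * energy f) / (√((d : ℝ) / (2 * N) * energy f) / 2)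
        = 16 * √(2 * N * G / d) := by
      have : √(2 * N * G / d) = √(G * energy f) / √((d : ℝ) / (2 * N) * energy f) := by
        rw [← Real.sqrt_div (by positivity)]
        congr 1
        field_simp
      rw [this]; field_simp; norm_num
    rw [h1]
    have h2 : √((d : ℝ) / 48) ≤ √(I.card / 24) := Real.sqrt_le_sqrt (by linarith)
    exact mul_le_mul_of_nonneg_left
      (div_le_div_of_nonneg_left (by positivity) (Real.sqrt_pos.2 (by positivity)) h2) (by norm_num)

/-- No row of the list makes the energy drop by more than the factor `H`. -/
def Steady (H : ℝ) (f : Finset α → ℝ) : List (α → Bool) → Prop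
  | [] => True
  | a :: l => Steady H f l ∧ energy (rowSteps l f) / H ≤ energy (rowStep a (rowSteps l f))

/-- The failure bound doubles with every row, so the geometric sum up to one stage equals the bound
for the next; the constant 4/3 is preserved by the induction. -/
theorem unifProb_not_steady_le {f : Finset α → ℝ} {c n : ℕ} (hf : SupportedOnCard f c)
    (hn : c + n ≤ Fintype.card α) :
    unifProb (fun w : Fin n → α → Bool => ¬ Steady (4 * Fintype.card α) f (List.ofFn w))
      ≤ 4 / 3 * (1 / 2) ^ (Fintype.card α - (c + n)) := by
  induction n with
  | zero =>
    rw [unifProb_false]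
    · positivity
    · simp [Steady]
  | succ n ih =>
    rw [unifProb_cons]
    have h1 : unifProb (fun x : (α → Bool) × (Fin n → α → Bool) =>
          ¬ Steady (4 * Fintype.card α) f (List.ofFn (Fin.cons x.1 x.2 : Fin (n + 1) → α → Bool)))
        ≤ unifProb (fun x : (α → Bool) × (Fin n → α → Bool) =>
            ¬ Steady (4 * Fintype.card α) f (List.ofFn x.2))
          + unifProb (fun x : (α → Bool) × (Fin n → α → Bool) =>
            energy (rowStep x.1 (rowSteps (List.ofFn x.2) f))
              < energy (rowSteps (List.ofFn x.2) f) / (4 * Fintype.card α)) := by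
      refine unifProb_le_add fun x hx => ?_
      by_contra hcon
      push Not at hcon
      refine hx ?_
      rw [List.ofFn_cons]
      exact ⟨hcon.1, hcon.2⟩
    have h2 := ih (by omega)
    have h3 : unifProb (fun x : (α → Bool) × (Fin n → α → Bool) =>
            ¬ Steady (4 * Fintype.card α) f (List.ofFn x.2))
        ≤ 4 / 3 * (1 / 2) ^ (Fintype.card α - (c + n)) := by
      rw [unifProb_prod' fun (_ : α → Bool) (w : Fin n → α → Bool) =>
        ¬ Steady (4 * Fintype.card α) f (List.ofFn w)]
      refine le_trans ?_ h2
      unfold unifProb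
      exact le_of_eq (Finset.expect_congr rfl fun w _ => Fintype.expect_const _)
    have h4 : unifProb (fun x : (α → Bool) × (Fin n → α → Bool) =>
            energy (rowStep x.1 (rowSteps (List.ofFn x.2) f))
              < energy (rowSteps (List.ofFn x.2) f) / (4 * Fintype.card α))
        ≤ 4 / 3 * (1 / 2) ^ (Fintype.card α - (c + n)) := by
      rw [unifProb_prod' fun (a : α → Bool) (w : Fin n → α → Bool) =>
        energy (rowStep a (rowSteps (List.ofFn w) f))
              < energy (rowSteps (List.ofFn w) f) / (4 * Fintype.card α)]
      refine expect_le_of_le (by positivity) fun w => ?_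
      have := hf.rowSteps (List.ofFn w)
      rw [List.length_ofFn] at this
      exact unifProb_energy_rowStep_lt_le this (by omega)
    have h5 : (1 / 2 : ℝ) ^ (Fintype.card α - (c + n))
        = 1 / 2 * (1 / 2) ^ (Fintype.card α - (c + (n + 1))) := by
      rw [← pow_succ']; congr 1; omega
    rw [h5] at h3 h4
    linarith

end RowStep

theorem unifProb_snd {Ω Ω' : Type*} [Fintype Ω] [Fintype Ω'] [Nonempty Ω] (p : Ω' → Prop) :
    unifProb (fun x : Ω × Ω' => p x.2) = unifProb p := by
  rw [unifProb_prod' fun (_ : Ω) (w : Ω') => p w]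
  unfold unifProb
  exact Finset.expect_congr rfl fun w _ => Fintype.expect_const _

/-- If `p · b` has probability at most `c` for all `b` with `q b`, then the joint event has
probability at most `c * P(q)`. -/
theorem unifProb_prod_le_mul {Ω Ω' : Type*} [Fintype Ω] [Fintype Ω'] {q : Ω' → Prop}
    {p : Ω → Ω' → Prop} {c : ℝ} (h : ∀ b, q b → unifProb (fun a => p a b) ≤ c) :
    unifProb (fun x : Ω × Ω' => q x.2 ∧ p x.1 x.2) ≤ c * unifProb q := by
  classical
  rw [unifProb_prod' fun (a : Ω) (b : Ω') => q b ∧ p a b]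
  rw [unifProb, Finset.mul_expect]
  refine Finset.expect_le_expect fun b _ => ?_
  by_cases hb : q b
  · simpa [hb] using h b hb
  · simp [hb, unifProb_false]

/-! ### Growth of the energy along many rows, and selection of good rows. -/

section Growth
variable {α : Type*} [DecidableEq α] [Fintype α]

/-- All steps are steady, but the energy is smaller than it would be if all but `j` of the `n`
steps had multiplied it by `G`. -/
def SlowGrowth (G H : ℝ) (f : Finset α → ℝ) (n j : ℕ) (l : List (α → Bool)) : Prop :=
  Steady H f l ∧ energy (rowSteps l f) < energy f * G ^ n / (G * H) ^ j

/-- Steadiness bounds the loss of the last step by `H`, which is what one exceptional step is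
allowed. -/
theorem SlowGrowth.tail {G H : ℝ} (hG : 0 < G) (hH : 0 < H) {f : Finset α → ℝ} {n j : ℕ}
    {a : α → Bool} {l : List (α → Bool)} (h : SlowGrowth G H f (n + 1) (j + 1) (a :: l)) :
    SlowGrowth G H f n j l := by
  refine ⟨h.1.1, ?_⟩
  have h1 := h.1.2.trans_lt h.2
  rw [div_lt_iff₀ hH] at h1
  refine h1.trans_eq ?_
  field_simp
  ring

/-- Slow growth forces at least `j` steps that miss the factor `G`, each of conditional probability
at most η; 2^n bounds the choices of their positions. The induction is Pascal's rule: the last step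
either gains `G`, leaving `j + 1` failures for the earlier ones, or fails and leaves `j`. -/
theorem unifProb_slowGrowth_le {f : Finset α → ℝ} {c K : ℕ} (hf : SupportedOnCard f c)
    {G H η : ℝ} (hG : 0 < G) (hH : 0 < H) (hGH : 1 ≤ G * H)
    (hη0 : 0 ≤ η) (hη : ∀ k < c + K, ∀ g : Finset α → ℝ, SupportedOnCard g k →
      unifProb (fun a => energy (rowStep a g) < G * energy g) ≤ η)
    {n : ℕ} (hn : n ≤ K) (j : ℕ) :
    unifProb (fun w : Fin n → α → Bool => SlowGrowth G H f n j (List.ofFn w)) ≤ 2 ^ n * η ^ j := by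
  induction n generalizing j with
  | zero =>
    rw [unifProb_false]
    · positivity
    · rintro w ⟨-, h⟩
      simp only [List.ofFn_zero, rowSteps_nil, pow_zero, mul_one] at h
      have := div_le_self (energy_nonneg f) (one_le_pow₀ hGH (n := j))
      linarith
  | succ n ih =>
    rcases j with _ | j
    · refine (unifProb_le_one _).trans ?_
      rw [pow_zero, mul_one]
      exact one_le_pow₀ one_le_two
    rw [unifProb_cons]
    have h1 : unifProb (fun x : (α → Bool) × (Fin n → α → Bool) => SlowGrowth G H f (n + 1) (j + 1)
          (List.ofFn (Fin.cons x.1 x.2 : Fin (n + 1) → α → Bool)))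
        ≤ unifProb (fun x : (α → Bool) × (Fin n → α → Bool) =>
            SlowGrowth G H f n (j + 1) (List.ofFn x.2))
          + unifProb (fun x : (α → Bool) × (Fin n → α → Bool) =>
            SlowGrowth G H f n j (List.ofFn x.2) ∧
            energy (rowStep x.1 (rowSteps (List.ofFn x.2) f))
              < G * energy (rowSteps (List.ofFn x.2) f)) := by
      refine unifProb_le_add fun x hx => ?_
      rw [List.ofFn_cons] at hx
      by_cases hc : energy (rowStep x.1 (rowSteps (List.ofFn x.2) f))
              < G * energy (rowSteps (List.ofFn x.2) f)
      · exact Or.inr ⟨hx.tail hG hH, hc⟩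
      · left
        push Not at hc
        refine ⟨hx.1.1, ?_⟩
        have h2 := hc.trans_lt hx.2
        rw [pow_succ', ← mul_assoc, mul_comm _ G, mul_assoc, mul_div_assoc] at h2
        exact lt_of_mul_lt_mul_left h2 hG.le
    refine h1.trans ?_
    rw [unifProb_snd (Ω := α → Bool) fun w : Fin n → α → Bool =>
      SlowGrowth G H f n (j + 1) (List.ofFn w)]
    have h2 := unifProb_prod_le_mul (c := η)
      (q := fun w : Fin n → α → Bool => SlowGrowth G H f n j (List.ofFn w))
      (p := fun a w => energy (rowStep a (rowSteps (List.ofFn w) f))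
              < G * energy (rowSteps (List.ofFn w) f)) (fun w _ => by
        have := hf.rowSteps (List.ofFn w)
        rw [List.length_ofFn] at this
        exact hη _ (by omega) _ this)
    have h3 := ih (by omega) (j + 1)
    have h4 := mul_le_mul_of_nonneg_left (ih (by omega) j) hη0
    calc _ ≤ 2 ^ n * η ^ (j + 1) + η * (2 ^ n * η ^ j) := add_le_add h3 (h2.trans h4)
      _ = _ := by ring

/-- The final `i` steps, where too few lines are missing for growth, are all written off as
exceptional. -/
theorem unifProb_slowGrowth_add_le {f : Finset α → ℝ} {G H : ℝ} (hG : 0 < G) (hH : 0 < H)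
    (n j i : ℕ) :
    unifProb (fun w : Fin (n + i) → α → Bool => SlowGrowth G H f (n + i) (j + i) (List.ofFn w))
      ≤ unifProb (fun w : Fin n → α → Bool => SlowGrowth G H f n j (List.ofFn w)) := by
  induction i with
  | zero => exact le_rfl
  | succ i ih =>
    refine le_trans ?_ ih
    rw [← add_assoc, ← add_assoc, unifProb_cons, ← unifProb_snd (Ω := α → Bool)
      fun w : Fin (n + i) → α → Bool => SlowGrowth G H f (n + i) (j + i) (List.ofFn w)]
    refine unifProb_mono fun x hx => ?_
    rw [List.ofFn_cons] at hx
    exact hx.tail hG hH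

/-- With enough candidate rows available, one can choose `q` of them along which the energy never
drops much. -/
theorem unifProb_not_exists_selection_le {f : Finset α → ℝ} {c : ℕ} (hf : SupportedOnCard f c)
    (t q : ℕ) (hq : c + q ≤ Fintype.card α) :
    unifProb (fun w : Fin t → α → Bool => ¬ ∃ l : List (Fin t), l.Nodup ∧ l.length = q ∧
        energy f / (4 * Fintype.card α) ^ q ≤ energy (rowSteps (l.map w) f))
      ≤ 2 ^ q * (5 / 6) ^ t := by
  induction t generalizing q with
  | zero =>
    rw [pow_zero, mul_one]
    exact (unifProb_le_one _).trans (one_le_pow₀ one_le_two)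
  | succ t ih =>
    rcases q with _ | q
    · rw [unifProb_false]
      · positivity
      · intro w hw
        exact hw ⟨[], by simp⟩
    set H : ℝ := 4 * Fintype.card α with hH
    have hH0 : 0 < H := by
      have : (0 : ℝ) < Fintype.card α := by exact_mod_cast (by omega : 0 < Fintype.card α)
      positivity
    set A : ℕ → (Fin t → α → Bool) → Prop := fun q w => ∃ l : List (Fin t), l.Nodup ∧
      l.length = q ∧ energy f / H ^ q ≤ energy (rowSteps (l.map w) f) with hA
    have hlift : ∀ (a : α → Bool) (w : Fin t → α → Bool) (l : List (Fin t)),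
        (l.map Fin.succ).map (Fin.cons a w : Fin (t + 1) → α → Bool) = l.map w := by
      intro a w l; simp [Function.comp_def]
    rw [unifProb_cons]
    -- If `q + 1` rows cannot be selected even with the new candidate, then either the old
    -- candidates did not even allow `q`, or the new one extends no admissible selection of `q`. The
    -- latter has conditional probability at most 4/3 · 1/2 = 2/3.
    have h1 : unifProb (fun x : (α → Bool) × (Fin t → α → Bool) =>
        ¬ ∃ l : List (Fin (t + 1)), l.Nodup ∧ l.length = q + 1 ∧ energy f / H ^ (q + 1) ≤
          energy (rowSteps (l.map (Fin.cons x.1 x.2 : Fin (t + 1) → α → Bool)) f))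
        ≤ unifProb (fun x : (α → Bool) × (Fin t → α → Bool) => ¬ A (q + 1) x.2 ∧ ¬ A q x.2)
          + unifProb (fun x : (α → Bool) × (Fin t → α → Bool) => (¬ A (q + 1) x.2 ∧ A q x.2) ∧
            ∀ l : List (Fin t), l.Nodup ∧ l.length = q ∧
              energy f / H ^ q ≤ energy (rowSteps (l.map x.2) f) →
              energy (rowStep x.1 (rowSteps (l.map x.2) f))
                < energy (rowSteps (l.map x.2) f) / H) := by
      refine unifProb_le_add fun x hx => ?_
      have hn : ¬ A (q + 1) x.2 := by
        rintro ⟨l, hl1, hl2, hl3⟩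
        exact hx ⟨l.map Fin.succ, hl1.map (Fin.succ_injective _), by simpa using hl2, by
          rwa [hlift]⟩
      by_cases hAq : A q x.2
      · refine Or.inr ⟨⟨hn, hAq⟩, fun l hl => ?_⟩
        by_contra hle
        push Not at hle
        refine hx ⟨0 :: l.map Fin.succ, ?_, by simp [hl.2.1], ?_⟩
        · refine List.nodup_cons.2 ⟨by simp [Fin.succ_ne_zero], hl.1.map (Fin.succ_injective _)⟩
        · rw [List.map_cons, hlift, rowSteps_cons, Fin.cons_zero]
          refine le_trans ?_ hle
          rw [pow_succ, ← div_div]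
          exact div_le_div_of_nonneg_right hl.2.2 hH0.le
      · exact Or.inl ⟨hn, hAq⟩
    rw [unifProb_snd (Ω := α → Bool) fun w => ¬ A (q + 1) w ∧ ¬ A q w] at h1
    have h2 := unifProb_prod_le_mul (c := 2 / 3)
      (q := fun w : Fin t → α → Bool => ¬ A (q + 1) w ∧ A q w)
      (p := fun (a : α → Bool) w => ∀ l : List (Fin t), l.Nodup ∧ l.length = q ∧
              energy f / H ^ q ≤ energy (rowSteps (l.map w) f) →
              energy (rowStep a (rowSteps (l.map w) f)) < energy (rowSteps (l.map w) f) / H)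
      (fun w hw => by
        obtain ⟨l, hl⟩ := hw.2
        have hs := hf.rowSteps (l.map w)
        rw [List.length_map, hl.2.1] at hs
        refine (unifProb_mono fun a ha => ha l hl).trans
          ((unifProb_energy_rowStep_lt_le hs (by omega)).trans ?_)
        have : (1 / 2 : ℝ) ^ (Fintype.card α - (c + q)) ≤ 1 / 2 :=
          pow_le_of_le_one (by norm_num) (by norm_num) (by omega)
        linarith)
    have h3 : unifProb (fun w => ¬ A (q + 1) w ∧ ¬ A q w)
        + unifProb (fun w => ¬ A (q + 1) w ∧ A q w) = unifProb (fun w => ¬ A (q + 1) w) := by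
      classical
      unfold unifProb
      rw [← Finset.expect_add_distrib]
      refine Finset.expect_congr rfl fun w _ => ?_
      by_cases h1 : A (q + 1) w <;> by_cases h2 : A q w <;> simp [h1, h2]
    have h4 : unifProb (fun w => ¬ A (q + 1) w ∧ ¬ A q w) ≤ unifProb (fun w => ¬ A q w) :=
      unifProb_mono fun w hw => hw.2
    have h5 := ih (q + 1) hq
    have h6 := ih q (by omega)
    change unifProb (fun w => ¬ A (q + 1) w) ≤ _ at h5
    change unifProb (fun w => ¬ A q w) ≤ _ at h6
    -- The bound 2^q (5/6)^t solves the recursion p(q+1, t+1) = (2/3) p(q+1, t) + (1/3) p(q, t).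
    have h7 : (2 : ℝ) ^ (q + 1) * (5 / 6) ^ (t + 1)
        = 2 / 3 * (2 ^ (q + 1) * (5 / 6) ^ t) + 1 / 3 * (2 ^ q * (5 / 6) ^ t) := by ring
    rw [h7]
    linarith

end Growth

/-! ### Minors -/

/-- The permanents of the minors without rows. -/
def emptyMinor {α : Type*} [DecidableEq α] (A : Finset α) : ℝ := if A = ∅ then 1 else 0

theorem supportedOnCard_emptyMinor {α : Type*} [DecidableEq α] :
    SupportedOnCard (emptyMinor (α := α)) 0 := by
  intro A hA
  by_contra h
  exact hA (if_neg fun h0 => h (by simp [h0]))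

section Minors
variable {R C : Type*} [DecidableEq R] [DecidableEq C]

/-- Laplace expansion along a column. -/
theorem rowSteps_map_eq_sum_column (M : R → C → Bool) {c : C} (lr : List R) (hlr : lr.Nodup)
    {B : Finset C} (hc : c ∈ B) :
    rowSteps (lr.map M) emptyMinor B = ∑ r ∈ lr.toFinset,
      boolSign (M r c) * rowSteps ((lr.erase r).map M) emptyMinor (B.erase c) := by
  induction lr generalizing B with
  | nil => simp [emptyMinor, Finset.ne_empty_of_mem hc]
  | cons r₀ lr ih =>
    obtain ⟨hr₀, hlr⟩ := List.nodup_cons.1 hlr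
    have hr₀' : r₀ ∉ lr.toFinset := by simpa using hr₀
    rw [List.toFinset_cons, Finset.sum_insert hr₀', List.erase_cons_head, List.map_cons,
      rowSteps_cons, rowStep, ← Finset.add_sum_erase _ _ hc]
    congr 1
    have h1 : ∀ j ∈ B.erase c, boolSign (M r₀ j) * rowSteps (lr.map M) emptyMinor (B.erase j)
        = ∑ r ∈ lr.toFinset, boolSign (M r₀ j) * (boolSign (M r c) *
            rowSteps ((lr.erase r).map M) emptyMinor ((B.erase c).erase j)) := by
      intro j hj
      rw [ih hlr (B := B.erase j) (Finset.mem_erase.2 ⟨(Finset.ne_of_mem_erase hj).symm, hc⟩),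
        Finset.mul_sum, Finset.erase_right_comm]
    rw [Finset.sum_congr rfl h1, Finset.sum_comm]
    refine Finset.sum_congr rfl fun r hr => ?_
    have hne : r₀ ≠ r := fun h => hr₀' (h ▸ hr)
    rw [List.erase_cons_tail (by simpa using hne), List.map_cons, rowSteps_cons, rowStep,
      Finset.mul_sum]
    exact Finset.sum_congr rfl fun j _ => by ring

/-- Expanding a minor along rows or along columns gives the same value. -/
theorem rowSteps_map_transpose (M : R → C → Bool) (lr : List R) (hlr : lr.Nodup) (lc : List C)
    (hlc : lc.Nodup) :
    rowSteps (lr.map M) emptyMinor lc.toFinset =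
      rowSteps (lc.map fun c r => M r c) emptyMinor lr.toFinset := by
  induction lc generalizing lr with
  | nil => cases lr <;> simp [emptyMinor, rowStep]
  | cons c lc ih =>
    obtain ⟨hc, hlc⟩ := List.nodup_cons.1 hlc
    rw [rowSteps_map_eq_sum_column M lr hlr (c := c) (by simp), List.map_cons, rowSteps_cons,
      rowStep]
    refine Finset.sum_congr rfl fun r hr => ?_
    have h1 : (c :: lc).toFinset.erase c = lc.toFinset := by
      rw [List.toFinset_cons, Finset.erase_insert (by simpa using hc)]
    have h2 : (lr.erase r).toFinset = lr.toFinset.erase r := by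
      ext x
      simp only [List.mem_toFinset, Finset.mem_erase, hlr.mem_erase_iff]
    rw [h1, ih (lr.erase r) (hlr.erase r) hlc, h2]

/-- The condition `B.card = k` forces every contributing `f` to be injective, so the sum runs over
bijections onto `B`. -/
theorem rowSteps_ofFn_eq_sum [Fintype C] {k : ℕ} (X : Fin k → C → Bool) (B : Finset C) :
    rowSteps (List.ofFn X) emptyMinor B = ∑ f : Fin k → C,
      if Finset.univ.image f = B ∧ B.card = k then ∏ i, boolSign (X i (f i)) else 0 := by
  induction k generalizing B with
  | zero =>
    by_cases hB : B = ∅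
    · simp [emptyMinor, hB]
    · simp [emptyMinor, hB]
  | succ k ih =>
    rw [List.ofFn_succ, rowSteps_cons, rowStep]
    simp only [ih]
    rw [← (Fin.consEquiv fun _ => C).sum_comp, Fintype.sum_prod_type]
    rw [← Finset.sum_subset (Finset.subset_univ B)]
    · refine Finset.sum_congr rfl fun j hj => ?_
      rw [Finset.mul_sum]
      refine Finset.sum_congr rfl fun g _ => ?_
      have hiff : (Finset.univ.image g = B.erase j ∧ (B.erase j).card = k) ↔
          (Finset.univ.image (Fin.consEquiv (fun _ => C) (j, g)) = B ∧ B.card = k + 1) := by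
        have himg : Finset.univ.image (Fin.consEquiv (fun _ => C) (j, g))
            = insert j (Finset.univ.image g) := by
          ext x
          simp [Fin.consEquiv, Fin.exists_fin_succ, eq_comm]
        rw [himg, ← Finset.card_erase_add_one hj, add_left_inj]
        constructor
        · rintro ⟨h1, h2⟩
          exact ⟨by rw [h1, Finset.insert_erase hj], h2⟩
        · rintro ⟨h1, h2⟩
          refine ⟨?_, h2⟩
          have hjn : j ∉ Finset.univ.image g := by
            intro hmem
            rw [Finset.insert_eq_of_mem hmem] at h1
            have h3 : B.card ≤ k := by
              rw [← h1]
              exact Finset.card_image_le.trans (by simp)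
            have h4 := Finset.card_erase_add_one hj
            omega
          rw [← h1, Finset.erase_insert hjn]
      simp only [hiff]
      split_ifs
      · rw [Fin.prod_univ_succ]; simp [Fin.consEquiv]
      · simp
    · intro j _ hj
      refine Finset.sum_eq_zero fun g _ => if_neg ?_
      rintro ⟨h1, -⟩
      refine hj (h1 ▸ Finset.mem_image.2 ⟨0, Finset.mem_univ _, ?_⟩)
      simp [Fin.consEquiv]

theorem permanent_boolSign_eq {n : ℕ} (X : Fin n → Fin n → Bool) :
    (Matrix.of fun i j => boolSign (X i j)).permanent
      = rowSteps (List.ofFn X) emptyMinor Finset.univ := by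
  rw [rowSteps_ofFn_eq_sum, ← Matrix.permanent_transpose, Matrix.permanent, ← Finset.sum_filter]
  refine Finset.sum_bij (fun σ _ => ⇑σ) ?_ ?_ ?_ ?_
  · intro σ _
    simp
  · intro σ _ τ _ h
    exact DFunLike.coe_injective h
  · intro f hf
    have hsurj : Function.Surjective f := by
      have := (Finset.mem_filter.1 hf).2.1
      intro y
      have hy : y ∈ Finset.univ.image f := by rw [this]; exact Finset.mem_univ y
      simpa using hy
    exact ⟨Equiv.ofBijective f ⟨Finite.injective_iff_surjective.2 hsurj, hsurj⟩,
      Finset.mem_univ _, rfl⟩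
  · intro σ _
    rfl

end Minors

theorem energy_eq_of_supportedOnCard {C : Type*} [Fintype C] {f : Finset C → ℝ}
    (hf : SupportedOnCard f (Fintype.card C)) : energy f = f Finset.univ ^ 2 := by
  rw [energy, Finset.sum_eq_single Finset.univ]
  · intro A _ hA
    have : f A = 0 := by
      by_contra h
      exact hA ((Finset.card_eq_iff_eq_univ A).1 (hf A h))
    simp [this]
  · simp

/-! ### Robustly large minors -/

section Rich
variable {α : Type*} [DecidableEq α]

/-- Many sets obtained from `B` by removing `j` elements, in the sense of an `m`-branching tree of
depth `j`, carry values of `f` of size at least `L`. -/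
def Rich (m : ℕ) (L : ℝ) (f : Finset α → ℝ) : ℕ → Finset α → Prop
  | 0, B => L ≤ |f B|
  | j + 1, B => ∃ Y ⊆ B, Y.card = m ∧ ∀ y ∈ Y, Rich m L f j (B.erase y)

variable [Fintype α]

/-- By Markov at least half of the `m` children keep values of size `L` after `j` rows, and
Littlewood–Offord for the next row preserves the threshold at the parent. The failure bounds obey
b(j+1) = 2b(j) + κ. -/
theorem Rich.unifProb_lt_le {m : ℕ} {L : ℝ} {f : Finset α → ℝ} (hm : 0 < m) (hL : 0 < L) {j : ℕ}
    {B : Finset α} (h : Rich m L f j B) :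
    unifProb (fun w : Fin j → α → Bool => |rowSteps (List.ofFn w) f B| < L)
      ≤ (2 ^ j - 1) * (1 / √((m : ℝ) / 2)) := by
  classical
  have hm0 : (0 : ℝ) < m := by exact_mod_cast hm
  set κ : ℝ := 1 / √((m : ℝ) / 2) with hκ
  have hκ0 : 0 ≤ κ := by positivity
  induction j generalizing B with
  | zero =>
    rw [unifProb_false]
    · simp
    · intro w
      simpa [Rich] using h
  | succ j ih =>
    obtain ⟨Y, hYB, hYm, hY⟩ := h
    set good : (Fin j → α → Bool) → Finset α := fun w =>
      Y.filter fun y => L ≤ |rowSteps (List.ofFn w) f (B.erase y)| with hgood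
    set bad : (Fin j → α → Bool) → ℝ := fun w => ∑ y ∈ Y,
      if |rowSteps (List.ofFn w) f (B.erase y)| < L then (1 : ℝ) else 0 with hbad
    have hsum : ∀ w, bad w + (good w).card = m := by
      intro w
      rw [← hYm, ← Finset.card_filter_add_card_filter_not
        (s := Y) (fun y => |rowSteps (List.ofFn w) f (B.erase y)| < L), hbad]
      simp only [Finset.sum_boole, hgood, not_lt]
      push_cast
      rfl
    have hbad1 : unifProb (fun w => (m : ℝ) / 2 ≤ bad w) ≤ 2 * ((2 ^ j - 1) * κ) := by
      have h1 := mul_unifProb_le_expect (f := bad)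
        (fun w => Finset.sum_nonneg fun y _ => by split_ifs <;> norm_num) ((m : ℝ) / 2)
      have h2 : 𝔼 w, bad w ≤ m * ((2 ^ j - 1) * κ) := by
        rw [hbad, Finset.expect_sum_comm, ← hYm, ← nsmul_eq_mul]
        refine Finset.sum_le_card_nsmul _ _ _ fun y hy => ?_
        refine le_trans (le_of_eq ?_) (ih (hY y hy))
        unfold unifProb
        exact Finset.expect_congr rfl fun w _ => by congr
      have h3 : (m : ℝ) / 2 * unifProb (fun w => (m : ℝ) / 2 ≤ bad w)
          ≤ (m : ℝ) / 2 * (2 * ((2 ^ j - 1) * κ)) := by linarith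
      exact le_of_mul_le_mul_left h3 (by positivity)
    rw [unifProb_cons]
    have h1 : unifProb (fun x : (α → Bool) × (Fin j → α → Bool) =>
          |rowSteps (List.ofFn (Fin.cons x.1 x.2 : Fin (j + 1) → α → Bool)) f B| < L)
        ≤ unifProb (fun x : (α → Bool) × (Fin j → α → Bool) => (m : ℝ) / 2 ≤ bad x.2)
          + unifProb (fun x : (α → Bool) × (Fin j → α → Bool) => bad x.2 < (m : ℝ) / 2 ∧
            |rowStep x.1 (rowSteps (List.ofFn x.2) f) B| < L) := by
      refine unifProb_le_add fun x hx => ?_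
      rw [List.ofFn_cons] at hx
      rcases le_or_gt ((m : ℝ) / 2) (bad x.2) with h | h
      · exact Or.inl h
      · exact Or.inr ⟨h, hx⟩
    rw [unifProb_snd (Ω := α → Bool) fun w : Fin j → α → Bool => (m : ℝ) / 2 ≤ bad w] at h1
    have h2 := unifProb_prod_le_mul (c := κ)
      (q := fun w : Fin j → α → Bool => bad w < (m : ℝ) / 2)
      (p := fun (a : α → Bool) w => |rowStep a (rowSteps (List.ofFn w) f) B| < L) (fun w hw => by
        have hc : (m : ℝ) / 2 ≤ (good w).card := by linarith [hsum w]
        have hne : (good w).Nonempty := by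
          rw [← Finset.card_pos]
          have : (0 : ℝ) < (good w).card := lt_of_lt_of_le (by positivity) hc
          exact_mod_cast this
        set v : α → ℝ := fun i => if i ∈ B then rowSteps (List.ofFn w) f (B.erase i) else 0
        have hv : ∀ a : α → Bool, rowStep a (rowSteps (List.ofFn w) f) B
            = ∑ i, boolSign (a i) * v i := by
          intro a
          simp only [v, mul_ite, mul_zero, ← Finset.sum_filter]
          simp [rowStep]
        simp only [hv]
        refine (unifProb_abs_signed_sum_lt_le v (good w) hne hL fun i hi => ?_).trans ?_
        · obtain ⟨hi1, hi2⟩ := Finset.mem_filter.1 hi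
          simp only [v, if_pos (hYB hi1)]
          exact hi2
        · exact one_div_le_one_div_of_le (Real.sqrt_pos.2 (by positivity)) (Real.sqrt_le_sqrt hc))
    have h3 : κ * unifProb (fun w : Fin j → α → Bool => bad w < (m : ℝ) / 2) ≤ κ :=
      mul_le_of_le_one_right hκ0 (unifProb_le_one _)
    calc _ ≤ 2 * ((2 ^ j - 1) * κ) + κ := h1.trans (add_le_add hbad1 (h2.trans h3))
      _ = _ := by ring

/-- If `B` is not rich, then few sequences of `j` elements of `B` can be removed with a large
value remaining. -/
theorem unifProb_large_le_of_not_rich {m : ℕ} {L : ℝ} {f : Finset α → ℝ} {j : ℕ}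
    {B : Finset α} (h : ¬ Rich m L f j B) :
    unifProb (fun z : Fin j → α => Function.Injective z ∧ (∀ i, z i ∈ B) ∧
      L ≤ |f (B \ Finset.univ.image z)|) ≤ j * (m / Fintype.card α) := by
  classical
  induction j generalizing B with
  | zero =>
    rw [unifProb_false]
    · simp
    · rintro z ⟨-, -, hz⟩
      exact h (by simpa [Rich] using hz)
  | succ j ih =>
    rw [unifProb_cons]
    -- With `m` or more such `y`, any `m` of them would witness richness of `B`. For every other
    -- first element in `B` the induction hypothesis applies.
    have hcount : unifProb (fun y => y ∈ B ∧ Rich m L f j (B.erase y)) ≤ m / Fintype.card α := by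
      rw [unifProb_eq_card_div]
      gcongr
      by_contra hlt
      push Not at hlt
      obtain ⟨Y, hY, hYm⟩ := Finset.exists_subset_card_eq hlt.le
      refine h ⟨Y, fun y hy => (Finset.mem_filter.1 (hY hy)).2.1, hYm, fun y hy =>
        (Finset.mem_filter.1 (hY hy)).2.2⟩
    have := unifProb_prod_le_add (q := fun y => y ∈ B ∧ Rich m L f j (B.erase y))
      (p := fun (y : α) (z : Fin j → α) =>
        Function.Injective (Fin.cons y z : Fin (j + 1) → α) ∧
        (∀ i, (Fin.cons y z : Fin (j + 1) → α) i ∈ B) ∧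
        L ≤ |f (B \ Finset.univ.image (Fin.cons y z : Fin (j + 1) → α))|)
      (c := j * (m / Fintype.card α)) (by positivity) (fun y hy => by
        by_cases hyB : y ∈ B
        · refine (unifProb_mono fun z hz => ?_).trans (ih fun hr => hy ⟨hyB, hr⟩)
          obtain ⟨h1, h2, h3⟩ := hz
          rw [Fin.cons_injective_iff] at h1
          refine ⟨h1.2, fun i => Finset.mem_erase.2 ⟨fun he => h1.1 ⟨i, he⟩,
            by simpa using h2 i.succ⟩, ?_⟩
          have : B.erase y \ Finset.univ.image z
              = B \ Finset.univ.image (Fin.cons y z : Fin (j + 1) → α) := by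
            ext x
            simp only [Finset.mem_sdiff, Finset.mem_erase, Finset.mem_image, Finset.mem_univ,
              true_and, Fin.exists_fin_succ, Fin.cons_zero, Fin.cons_succ]
            tauto
          rw [this]
          exact h3
        · rw [unifProb_false]
          · positivity
          · rintro z ⟨-, h2, -⟩
            exact hyB (by simpa using h2 0))
    refine this.trans ?_
    push_cast
    linarith

end Rich

/-! ### Random tuples -/

theorem unifProb_comp_injective {ι κ β : Type*} [Fintype ι] [DecidableEq ι] [Fintype κ]
    [DecidableEq κ] [Fintype β] [Nonempty β] {e : κ → ι} (he : Function.Injective e)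
    (p : (κ → β) → Prop) : unifProb (fun x : ι → β => p (x ∘ e)) = unifProb p := by
  classical
  let E₁ := Equiv.piEquivPiSubtypeProd (fun i => i ∈ Set.range e) (fun _ : ι => β)
  let E₂ : (κ → β) ≃ ({i // i ∈ Set.range e} → β) :=
    Equiv.arrowCongr (Equiv.ofInjective e he) (Equiv.refl β)
  let E : (ι → β) ≃ ({i // i ∉ Set.range e} → β) × (κ → β) :=
    (E₁.trans (Equiv.prodComm _ _)).trans (Equiv.prodCongr (Equiv.refl _) E₂.symm)
  rw [← unifProb_snd (Ω := {i // i ∉ Set.range e} → β) p, ← unifProb_equiv E]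
  rfl

theorem unifProb_not_injective_le {t : ℕ} {β : Type*} [Fintype β] [Nonempty β] :
    unifProb (fun x : Fin t → β => ¬ Function.Injective x) ≤ (t : ℝ) ^ 2 / Fintype.card β := by
  classical
  have h1 : ∀ p ∈ (Finset.univ : Finset (Fin t)).offDiag,
      unifProb (fun x : Fin t → β => x p.1 = x p.2) ≤ 1 / Fintype.card β := by
    intro p hp
    have hne : p.2 ≠ p.1 := (Finset.mem_offDiag.1 hp).2.2.symm
    unfold unifProb
    rw [expect_update p.1]
    refine expect_le_of_le (by positivity) fun x => ?_
    simp only [Function.update_self, Function.update_of_ne hne]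
    rw [Fintype.expect_eq_sum_div_card]
    simp
  calc _ ≤ unifProb (fun x : Fin t → β =>
          ∃ p ∈ (Finset.univ : Finset (Fin t)).offDiag, x p.1 = x p.2) := by
        refine unifProb_mono fun x hx => ?_
        simp only [Function.Injective] at hx
        push Not at hx
        obtain ⟨i, j, hij, hne⟩ := hx
        exact ⟨(i, j), by simp [hne], hij⟩
    _ ≤ ∑ p ∈ (Finset.univ : Finset (Fin t)).offDiag, 1 / (Fintype.card β : ℝ) :=
        (unifProb_exists_le _ _).trans (Finset.sum_le_sum h1)
    _ ≤ _ := by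
        rw [Finset.sum_const, nsmul_eq_mul, mul_one_div]
        gcongr
        rw [Finset.offDiag_card, Finset.card_univ, Fintype.card_fin, sq]
        exact_mod_cast Nat.sub_le _ _

/-- If every `t` columns contain, with high probability, some `s` columns whose removal leaves a
large minor, then with high probability large minors are abundant. -/
theorem unifProb_not_rich_le {N n s t m : ℕ} (hn : 0 < n) {L δ : ℝ}
    (h : ∀ x : Fin t → Fin n, Function.Injective x →
      unifProb (fun X : Fin N → Fin n → Bool => ¬ ∃ I : Finset (Fin t), I.card = s ∧
        L ≤ |rowSteps (List.ofFn X) emptyMinor (Finset.univ \ I.image x)|) ≤ δ)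
    (hδ : 0 ≤ δ) (hm : (2 : ℝ) ^ t * (s * (m / n)) ≤ 1 / 2) :
    unifProb (fun X : Fin N → Fin n → Bool =>
      ¬ Rich m L (rowSteps (List.ofFn X) emptyMinor) s Finset.univ) ≤ 2 * (δ + t ^ 2 / n) := by
  classical
  have : NeZero n := ⟨hn.ne'⟩
  set noneLarge : (Fin N → Fin n → Bool) → (Fin t → Fin n) → Prop := fun X x =>
    ¬ ∃ I : Finset (Fin t), I.card = s ∧
        L ≤ |rowSteps (List.ofFn X) emptyMinor (Finset.univ \ I.image x)| with hnone
  have hinj := unifProb_not_injective_le (t := t) (β := Fin n)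
  rw [Fintype.card_fin] at hinj
  have hjoint : unifProb (fun y : (Fin N → Fin n → Bool) × (Fin t → Fin n) =>
      Function.Injective y.2 ∧ noneLarge y.1 y.2) ≤ δ := by
    rw [unifProb_prod' fun X x => Function.Injective x ∧ noneLarge X x]
    refine expect_le_of_le hδ fun x => ?_
    by_cases hx : Function.Injective x
    · exact (unifProb_mono fun X hX => hX.2).trans (h x hx)
    · rw [unifProb_false fun X hX => hx hX.1]
      exact hδ
  rw [unifProb_prod fun X x => Function.Injective x ∧ noneLarge X x] at hjoint
  -- For a matrix that is not rich, a random tuple has some large minor with probability at most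
  -- 1/2, by a union bound over `I`. Thus with probability at least 1/2 it is non-injective or
  -- exhibits no large minor, which the hypothesis makes rare on average over `X`.
  have hpt : ∀ X : Fin N → Fin n → Bool,
      (1 / 2) * (if ¬ Rich m L (rowSteps (List.ofFn X) emptyMinor) s Finset.univ
        then (1 : ℝ) else 0) ≤
      (t : ℝ) ^ 2 / n + unifProb (fun x => Function.Injective x ∧ noneLarge X x) := by
    intro X
    by_cases hX : ¬ Rich m L (rowSteps (List.ofFn X) emptyMinor) s Finset.univ
    · rw [if_pos hX]
      set f := rowSteps (List.ofFn X) emptyMinor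
      have hI : ∀ I ∈ (Finset.univ : Finset (Fin t)).powersetCard s,
          unifProb (fun x : Fin t → Fin n => Function.Injective x ∧
            L ≤ |f (Finset.univ \ I.image x)|) ≤ s * (m / n) := by
        intro I hI
        have hIs := (Finset.mem_powersetCard.1 hI).2
        have h1 := unifProb_large_le_of_not_rich hX
        rw [Fintype.card_fin] at h1
        refine le_trans ?_ h1
        rw [← unifProb_comp_injective (I.orderEmbOfFin hIs).injective]
        refine unifProb_mono fun x hx => ⟨hx.1.comp (I.orderEmbOfFin hIs).injective,
          fun _ => Finset.mem_univ _, ?_⟩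
        have : Finset.univ.image (x ∘ I.orderEmbOfFin hIs) = I.image x := by
          rw [← Finset.image_image, Finset.image_orderEmbOfFin_univ]
        rw [this]
        exact hx.2
      have h2 : unifProb (fun x : Fin t → Fin n =>
          ∃ I ∈ (Finset.univ : Finset (Fin t)).powersetCard s, Function.Injective x ∧
            L ≤ |f (Finset.univ \ I.image x)|) ≤ 1 / 2 := by
        refine (unifProb_exists_le _ _).trans ((Finset.sum_le_card_nsmul _ _ _ hI).trans ?_)
        rw [nsmul_eq_mul]
        refine le_trans ?_ hm
        gcongr
        rw [Finset.card_powersetCard, Finset.card_univ, Fintype.card_fin]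
        exact_mod_cast Nat.choose_le_two_pow t s
      have h3 : unifProb (fun _ : Fin t → Fin n => True)
          ≤ unifProb (fun x : Fin t → Fin n => ¬ Function.Injective x)
            + unifProb (fun x => (Function.Injective x ∧ noneLarge X x) ∨
              ∃ I ∈ (Finset.univ : Finset (Fin t)).powersetCard s, Function.Injective x ∧
            L ≤ |f (Finset.univ \ I.image x)|) := by
        refine unifProb_le_add fun x _ => ?_
        by_cases hx : Function.Injective x
        · right
          by_cases hno : noneLarge X x
          · exact Or.inl ⟨hx, hno⟩
          · right
            simp only [hnone, not_not] at hno
            obtain ⟨I, hIs, hIL⟩ := hno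
            exact ⟨I, Finset.mem_powersetCard.2 ⟨Finset.subset_univ _, hIs⟩, hx, hIL⟩
        · exact Or.inl hx
      rw [unifProb_true fun _ => trivial] at h3
      have h4 := unifProb_or_le (fun x => Function.Injective x ∧ noneLarge X x) (fun x =>
        ∃ I ∈ (Finset.univ : Finset (Fin t)).powersetCard s, Function.Injective x ∧
            L ≤ |f (Finset.univ \ I.image x)|)
      linarith
    · rw [if_neg hX]
      have := unifProb_nonneg fun x => Function.Injective x ∧ noneLarge X x
      have h0 : (0 : ℝ) ≤ (t : ℝ) ^ 2 / n := by positivity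
      linarith
  have hfin := Finset.expect_le_expect (s := Finset.univ) fun X _ => hpt X
  rw [← Finset.mul_expect, Finset.expect_add_distrib, Fintype.expect_const] at hfin
  have hun : (𝔼 X : Fin N → Fin n → Bool,
      if ¬ Rich m L (rowSteps (List.ofFn X) emptyMinor) s Finset.univ then (1 : ℝ) else 0)
      = unifProb (fun X : Fin N → Fin n → Bool =>
      ¬ Rich m L (rowSteps (List.ofFn X) emptyMinor) s Finset.univ) := by
    unfold unifProb
    exact Finset.expect_congr rfl fun X _ => by congr
  rw [hun] at hfin
  linarith

/-- Among `t = s + r` given columns one can, with high probability, choose `s` whose removal leaves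
a large minor, provided that the remaining columns typically have large energy. -/
theorem unifProb_not_exists_removal_le {N K n s r t : ℕ} (hN : N = K + r) (ht : t = s + r)
    (hn : n = K + t) {L e δ : ℝ} (hLe : L ^ 2 ≤ e / (4 * N) ^ r)
    (hu : unifProb (fun u : Fin K → Fin N → Bool =>
      energy (rowSteps (List.ofFn u) emptyMinor) < e) ≤ δ)
    (x : Fin t → Fin n) (hx : Function.Injective x) :
    unifProb (fun X : Fin N → Fin n → Bool => ¬ ∃ I : Finset (Fin t), I.card = s ∧
        L ≤ |rowSteps (List.ofFn X) emptyMinor (Finset.univ \ I.image x)|)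
      ≤ δ + 2 ^ r * (5 / 6) ^ t := by
  classical
  have hcard : Fintype.card {j // j ∉ Set.range x} = K := by
    rw [Fintype.card_subtype_compl]
    have : Fintype.card {j // j ∈ Set.range x} = t := by
      rw [← Fintype.card_congr (Equiv.ofInjective x hx), Fintype.card_fin]
    rw [this, Fintype.card_fin]; omega
  let E : Fin n ≃ Fin K ⊕ Fin t := (Equiv.sumCompl (fun j => j ∈ Set.range x)).symm.trans
    ((Equiv.sumComm _ _).trans (Equiv.sumCongr (Fintype.equivFinOfCardEq hcard)
      (Equiv.ofInjective x hx).symm))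
  have hEx : ∀ i, E.symm (Sum.inr i) = x i := by
    intro i; simp [E]
  let y : Fin K → Fin n := fun i => E.symm (Sum.inl i)
  have hyinj : Function.Injective y := fun a b hab => Sum.inl_injective (E.symm.injective hab)
  have hyx : ∀ i j, y i ≠ x j := by
    intro i j hij
    rw [← hEx] at hij
    exact absurd (E.symm.injective hij) (by simp)
  have hcover : ∀ j, (∃ i, y i = j) ∨ ∃ i, x i = j := by
    intro j
    rcases hj : E j with i | i
    · exact Or.inl ⟨i, by rw [Equiv.symm_apply_eq]; exact hj.symm⟩
    · exact Or.inr ⟨i, by rw [← hEx, Equiv.symm_apply_eq]; exact hj.symm⟩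
  -- The matrix read by columns: the `K` columns outside the range of `x`, exposed first, and the
  -- `t` candidates.
  let Φ : (Fin N → Fin n → Bool) ≃ (Fin K → Fin N → Bool) × (Fin t → Fin N → Bool) :=
    ((Equiv.piComm fun (_ : Fin N) (_ : Fin n) => Bool).trans
      (Equiv.arrowCongr E (Equiv.refl _))).trans (Equiv.sumArrowEquivProdArrow _ _ _)
  have hstep : unifProb (fun X : Fin N → Fin n → Bool => ¬ ∃ I : Finset (Fin t), I.card = s ∧
        L ≤ |rowSteps (List.ofFn X) emptyMinor (Finset.univ \ I.image x)|)
      ≤ unifProb (fun p : (Fin K → Fin N → Bool) × (Fin t → Fin N → Bool) =>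
        ¬ (e ≤ energy (rowSteps (List.ofFn p.1) emptyMinor) ∧ ∃ l : List (Fin t), l.Nodup ∧
          l.length = r ∧ energy (rowSteps (List.ofFn p.1) emptyMinor) / (4 * N) ^ r ≤
            energy (rowSteps (l.map p.2) (rowSteps (List.ofFn p.1) emptyMinor)))) := by
    rw [← unifProb_equiv Φ]
    refine unifProb_mono fun X hX => ?_
    rintro ⟨he, l, hl, hlr, hle⟩
    -- The candidates left unselected are removed; there are t - r = s of them.
    refine hX ⟨Finset.univ \ l.toFinset, ?_, ?_⟩
    · rw [Finset.card_univ_sdiff, List.toFinset_card_of_nodup hl, Fintype.card_fin]; omega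
    · set lc : List (Fin n) := l.map x ++ (List.finRange K).map y with hlc
      have hlcn : lc.Nodup := by
        rw [hlc]
        refine List.Nodup.append (hl.map hx) ((List.nodup_finRange K).map hyinj) ?_
        intro j hj1 hj2
        obtain ⟨a, -, rfl⟩ := List.mem_map.1 hj1
        obtain ⟨b, -, hb⟩ := List.mem_map.1 hj2
        exact hyx b a hb
      have hset : Finset.univ \ (Finset.univ \ l.toFinset).image x = lc.toFinset := by
        ext j
        simp only [Finset.mem_sdiff, Finset.mem_univ, true_and, Finset.mem_image,
          List.mem_toFinset, hlc, List.mem_append, List.mem_map, List.mem_finRange]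
        constructor
        · intro hj
          rcases hcover j with ⟨i, hi⟩ | ⟨i, hi⟩
          · exact Or.inr ⟨i, hi⟩
          · left
            refine ⟨i, ?_, hi⟩
            by_contra hil
            exact hj ⟨i, hil, hi⟩
        · rintro (⟨i, hi, rfl⟩ | ⟨i, rfl⟩) ⟨i', hi', hii⟩
          · exact hi' (hx hii ▸ hi)
          · exact hyx i i' hii.symm
      have htr := rowSteps_map_transpose X (List.finRange N) (List.nodup_finRange N) lc hlcn
      have hrow : (List.finRange N).map X = List.ofFn X := (List.ofFn_eq_map).symm
      have hcol : (lc.map fun c r => X r c) = l.map (Φ X).2 ++ List.ofFn (Φ X).1 := by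
        rw [hlc, List.map_append, List.map_map, List.map_map, List.ofFn_eq_map]
        congr 1
      rw [hset, ← hrow, htr, hcol, rowSteps_append, List.toFinset_finRange]
      set g := rowSteps (l.map (Φ X).2) (rowSteps (List.ofFn (Φ X).1) emptyMinor) with hg
      -- After K + r = N columns only one minor remains, so its square is the whole energy.
      have hsupp : SupportedOnCard g (Fintype.card (Fin N)) := by
        have := (supportedOnCard_emptyMinor.rowSteps (List.ofFn (Φ X).1)).rowSteps (l.map (Φ X).2)
        rw [List.length_map, List.length_ofFn, hlr, zero_add, ← hN] at this
        rwa [Fintype.card_fin]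
      rw [energy_eq_of_supportedOnCard hsupp] at hle
      refine abs_le_of_sq_le_sq' ?_ (abs_nonneg _) |>.2
      rw [sq_abs]
      refine hLe.trans (le_trans ?_ hle)
      gcongr
  refine hstep.trans ?_
  have h2 := unifProb_prod_le_add
    (q := fun u : Fin K → Fin N → Bool => energy (rowSteps (List.ofFn u) emptyMinor) < e)
    (p := fun (u : Fin K → Fin N → Bool) (v : Fin t → Fin N → Bool) =>
        ¬ (e ≤ energy (rowSteps (List.ofFn u) emptyMinor) ∧ ∃ l : List (Fin t), l.Nodup ∧
          l.length = r ∧ energy (rowSteps (List.ofFn u) emptyMinor) / (4 * N) ^ r ≤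
            energy (rowSteps (l.map v) (rowSteps (List.ofFn u) emptyMinor))))
    (c := 2 ^ r * (5 / 6) ^ t) (by positivity) (fun u hu => by
      have hs := supportedOnCard_emptyMinor.rowSteps (List.ofFn u)
      rw [List.length_ofFn, zero_add] at hs
      have := unifProb_not_exists_selection_le hs t r (by rw [Fintype.card_fin]; omega)
      rw [Fintype.card_fin] at this
      refine (unifProb_mono fun v hv => ?_).trans this
      exact fun hex => hv ⟨not_lt.1 hu, hex⟩)
  linarith

/-! ### The permanent of a uniformly random sign matrix -/

theorem energy_emptyMinor {α : Type*} [Fintype α] [DecidableEq α] :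
    energy (emptyMinor (α := α)) = 1 := by
  rw [energy, Finset.sum_eq_single ∅]
  · simp [emptyMinor]
  · intro A _ hA
    simp [emptyMinor, hA]
  · simp

/-- During the first N - q lines at least `q` are missing, so η bounds every growth failure. The
next q - r are written off, and stopping with `r` missing keeps the chance of an unsteady step of
order 2^(-r). -/
theorem unifProb_energy_lt_le {N q r : ℕ} (hr : r ≤ q) (hq0 : 0 < q) (hq : q ≤ N) {G : ℝ}
    (hG : 0 < G) (hGH : 1 ≤ G * (4 * N)) (j : ℕ) :
    unifProb (fun u : Fin (N - r) → Fin N → Bool => energy (rowSteps (List.ofFn u) emptyMinor)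
        < G ^ (N - r) / (G * (4 * N)) ^ (j + (q - r)))
      ≤ 4 / 3 * (1 / 2) ^ r
        + 2 ^ N * (40 * ((16 * √(2 * N * G / q) + 1) / √((q : ℝ) / 48))) ^ j := by
  have hN0 : (0 : ℝ) < N := by exact_mod_cast (by omega : 0 < N)
  have hq0' : (0 : ℝ) < q := by exact_mod_cast hq0
  set η := 40 * ((16 * √(2 * N * G / q) + 1) / √((q : ℝ) / 48)) with hη
  have hη0 : 0 ≤ η := by positivity
  have hs := supportedOnCard_emptyMinor (α := Fin N)
  have h1 := unifProb_not_steady_le (n := N - r) hs (by rw [Fintype.card_fin]; omega)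
  rw [Fintype.card_fin, show N - (0 + (N - r)) = r by omega] at h1
  have h2 := unifProb_slowGrowth_le hs (K := N - q) hG (by positivity : (0 : ℝ) < 4 * N) hGH hη0
    (fun k hk g hg => by
      have := unifProb_energy_rowStep_lt_mul_le hg (by rw [Fintype.card_fin]; omega) hG
      rw [Fintype.card_fin] at this
      refine this.trans ?_
      have hd : (q : ℝ) ≤ ((N - k : ℕ) : ℝ) := by exact_mod_cast (by omega : q ≤ N - k)
      rw [hη]
      gcongr) le_rfl j
  have h3 := unifProb_slowGrowth_add_le (f := emptyMinor (α := Fin N)) hG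
    (by positivity : (0 : ℝ) < 4 * N) (N - q) j (q - r)
  rw [show N - q + (q - r) = N - r by omega] at h3
  have h4 : (2 : ℝ) ^ (N - q) * η ^ j ≤ 2 ^ N * η ^ j := by
    gcongr
    · norm_num
    · omega
  have h5 : unifProb (fun u : Fin (N - r) → Fin N → Bool =>
      energy (rowSteps (List.ofFn u) emptyMinor) < G ^ (N - r) / (G * (4 * N)) ^ (j + (q - r)))
      ≤ unifProb (fun u : Fin (N - r) → Fin N → Bool => ¬ Steady (4 * N) emptyMinor (List.ofFn u))
        + unifProb (fun u : Fin (N - r) → Fin N → Bool =>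
          SlowGrowth G (4 * N) emptyMinor (N - r) (j + (q - r)) (List.ofFn u)) := by
    refine unifProb_le_add fun u hu => ?_
    by_cases hst : Steady (4 * N) emptyMinor (List.ofFn u)
    · right
      refine ⟨hst, ?_⟩
      rwa [energy_emptyMinor, one_mul]
    · exact Or.inl hst
  linarith

/-- The last `N` rows are typically rich; conditionally on this, the independent first `s` rows turn
richness into a large permanent. -/
theorem unifProb_abs_permanent_lt_le {n N s r t m : ℕ} (hr : r ≤ N) (ht : t = s + r)
    (hn : n = s + N) (hn0 : 0 < n) (hm0 : 0 < m) {L e δ : ℝ} (hL : 0 < L)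
    (hLe : L ^ 2 ≤ e / (4 * N) ^ r) (hδ : 0 ≤ δ)
    (hu : unifProb (fun u : Fin (N - r) → Fin N → Bool =>
      energy (rowSteps (List.ofFn u) emptyMinor) < e) ≤ δ)
    (hm : (2 : ℝ) ^ t * (s * (m / n)) ≤ 1 / 2) :
    unifProb (fun X : Fin n → Fin n → Bool =>
        |(Matrix.of fun i j => boolSign (X i j)).permanent| < L)
      ≤ 2 * (δ + 2 ^ r * (5 / 6) ^ t + t ^ 2 / n) + 2 ^ s * (1 / √((m : ℝ) / 2)) := by
  have hrich := unifProb_not_rich_le (N := N) (L := L) (δ := δ + 2 ^ r * (5 / 6) ^ t) hn0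
    (fun x hx => unifProb_not_exists_removal_le (K := N - r) (by omega) ht (by omega) hLe hu x hx)
    (by positivity) hm
  have hpos : (0 : ℝ) ≤ 1 / √((m : ℝ) / 2) := by positivity
  simp only [permanent_boolSign_eq]
  rw [← unifProb_equiv ((Fin.appendEquiv s N).trans (Equiv.arrowCongr (finCongr hn.symm)
    (Equiv.refl (Fin n → Bool))))]
  have hlist : ∀ x : (Fin s → Fin n → Bool) × (Fin N → Fin n → Bool),
      List.ofFn (((Fin.appendEquiv s N).trans (Equiv.arrowCongr (finCongr hn.symm)
        (Equiv.refl (Fin n → Bool)))) x) = List.ofFn x.1 ++ List.ofFn x.2 := by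
    intro x
    rw [← List.ofFn_fin_append, List.ofFn_congr hn]
    rfl
  simp only [hlist, rowSteps_append]
  have h1 : unifProb (fun x : (Fin s → Fin n → Bool) × (Fin N → Fin n → Bool) =>
        |rowSteps (List.ofFn x.1) (rowSteps (List.ofFn x.2) emptyMinor) Finset.univ| < L)
      ≤ unifProb (fun x : (Fin s → Fin n → Bool) × (Fin N → Fin n → Bool) =>
          ¬ Rich m L (rowSteps (List.ofFn x.2) emptyMinor) s Finset.univ)
        + unifProb (fun x : (Fin s → Fin n → Bool) × (Fin N → Fin n → Bool) =>
          Rich m L (rowSteps (List.ofFn x.2) emptyMinor) s Finset.univ ∧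
          |rowSteps (List.ofFn x.1) (rowSteps (List.ofFn x.2) emptyMinor) Finset.univ| < L) := by
    refine unifProb_le_add fun x hx => ?_
    by_cases h : Rich m L (rowSteps (List.ofFn x.2) emptyMinor) s Finset.univ
    · exact Or.inr ⟨h, hx⟩
    · exact Or.inl h
  rw [unifProb_snd (Ω := Fin s → Fin n → Bool) fun X : Fin N → Fin n → Bool =>
    ¬ Rich m L (rowSteps (List.ofFn X) emptyMinor) s Finset.univ] at h1
  have h2 := unifProb_prod_le_mul (c := 2 ^ s * (1 / √((m : ℝ) / 2)))
    (q := fun X : Fin N → Fin n → Bool =>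
      Rich m L (rowSteps (List.ofFn X) emptyMinor) s Finset.univ)
    (p := fun (Y : Fin s → Fin n → Bool) X =>
      |rowSteps (List.ofFn Y) (rowSteps (List.ofFn X) emptyMinor) Finset.univ| < L)
    (fun X hX => (hX.unifProb_lt_le hm0 hL).trans
      (mul_le_mul_of_nonneg_right (by linarith) hpos))
  have h3 := mul_le_of_le_one_right (a := 2 ^ s * (1 / √((m : ℝ) / 2))) (by positivity)
    (unifProb_le_one fun X : Fin N → Fin n → Bool =>
      Rich m L (rowSteps (List.ofFn X) emptyMinor) s Finset.univ)
  linarith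

/-! ### Transfer to an arbitrary probability space -/

/-- Each sign pattern is a measurable event of mass 2^(-n²), and distinct patterns are disjoint.
Monotonicity then gives the lower bound with no measurability condition on `p`. -/
theorem IsBernoulliMatrix.unifProb_le {Ω : Type*} [MeasurableSpace Ω] {μ : Measure Ω}
    [IsProbabilityMeasure μ] {n : ℕ} {M : Ω → Matrix (Fin n) (Fin n) ℝ}
    (hM : IsBernoulliMatrix μ M) (p : Matrix (Fin n) (Fin n) ℝ → Prop) :
    unifProb (fun X : Fin n → Fin n → Bool => p (Matrix.of fun i j => boolSign (X i j)))
      ≤ μ.real {ω | p (M ω)} := by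
  classical
  set S : (Fin n → Fin n → Bool) → Set Ω := fun X =>
    ⋂ x ∈ (Finset.univ : Finset (Fin n × Fin n)),
      (fun ω => M ω x.1 x.2) ⁻¹' {boolSign (X x.1 x.2)} with hS
  have hmem : ∀ X ω, ω ∈ S X ↔ M ω = Matrix.of fun i j => boolSign (X i j) := by
    intro X ω
    simp only [hS, Set.mem_iInter, Finset.mem_univ, true_imp_iff, Set.mem_preimage,
      Set.mem_singleton_iff, Prod.forall]
    rw [← Matrix.ext_iff]
    rfl
  have hmeas : ∀ X, MeasurableSet (S X) := fun X =>
    Finset.measurableSet_biInter _ fun x _ =>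
      hM.measurable_entry x.1 x.2 (measurableSet_singleton _)
  have hμ : ∀ X, μ (S X) = (1 / 2 : ℝ≥0∞) ^ (n * n) := by
    intro X
    rw [hS]
    rw [hM.indep.measure_inter_preimage_eq_mul Finset.univ
      (sets := fun x => {boolSign (X x.1 x.2)}) (fun x _ => measurableSet_singleton _)]
    have : ∀ x ∈ (Finset.univ : Finset (Fin n × Fin n)),
        μ ((fun ω => M ω x.1 x.2) ⁻¹' {boolSign (X x.1 x.2)}) = 1 / 2 := by
      intro x _
      cases h : X x.1 x.2
      · exact hM.prob_neg_one x.1 x.2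
      · exact hM.prob_one x.1 x.2
    rw [Finset.prod_congr rfl this, Finset.prod_const]
    simp
  have hinj : ∀ X Y : Fin n → Fin n → Bool, (Matrix.of fun i j => boolSign (X i j)) =
      (Matrix.of fun i j => boolSign (Y i j)) → X = Y := by
    intro X Y h
    funext i j
    have := congrFun (congrFun h i) j
    simp only [Matrix.of_apply] at this
    cases hx : X i j <;> cases hy : Y i j <;> simp [hx, hy, boolSign] at this ⊢ <;> norm_num at this
  set F := Finset.univ.filter fun X : Fin n → Fin n → Bool =>
    p (Matrix.of fun i j => boolSign (X i j)) with hF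
  have hunion : μ (⋃ X ∈ F, S X) = F.card * (1 / 2 : ℝ≥0∞) ^ (n * n) := by
    rw [measure_biUnion_finset _ fun X _ => hmeas X]
    · simp [hμ]
    · intro X _ Y _ hXY
      refine Set.disjoint_left.2 fun ω hX hY => hXY (hinj X Y ?_)
      rw [← (hmem X ω).1 hX, ← (hmem Y ω).1 hY]
  have hsub : (⋃ X ∈ F, S X) ⊆ {ω | p (M ω)} := by
    intro ω hω
    simp only [Set.mem_iUnion] at hω
    obtain ⟨X, hX, hω⟩ := hω
    have := (Finset.mem_filter.1 hX).2
    rw [← (hmem X ω).1 hω] at this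
    exact this
  have h1 : μ.real (⋃ X ∈ F, S X) ≤ μ.real {ω | p (M ω)} := measureReal_mono hsub
  refine le_trans (le_of_eq ?_) h1
  rw [Measure.real, hunion, unifProb_eq_card_div]
  have : Fintype.card (Fin n → Fin n → Bool) = 2 ^ (n * n) := by
    simp [pow_mul]
  rw [this, ENNReal.toReal_mul, ENNReal.toReal_pow]
  simp [div_eq_mul_inv, hF]

/-! ### Numerical estimates -/

/-- The upper bound on `n` gives n^(-1/100) ≥ (1/4)^((r + 1)/5), and (3/4)^5 < 1/4. -/
theorem three_quarters_pow_le_rpow {r n : ℕ} (hn0 : 0 < n) (hn : n < 2 ^ (40 * (r + 1))) :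
    (3 / 4 : ℝ) ^ (r + 1) ≤ (n : ℝ) ^ (-(1 / 100) : ℝ) := by
  have h1 : ((2 : ℝ) ^ (40 * (r + 1))) ^ (-(1 / 100) : ℝ) ≤ (n : ℝ) ^ (-(1 / 100) : ℝ) := by
    have hn0' : (0 : ℝ) < n := by exact_mod_cast hn0
    have hn' : (n : ℝ) ≤ 2 ^ (40 * (r + 1)) := by exact_mod_cast hn.le
    exact Real.antitoneOn_rpow_Ioi_of_exponent_nonpos (by norm_num) hn0'
      (hn0'.trans_le hn') hn'
  refine le_trans ?_ h1
  have h2 : ((2 : ℝ) ^ (40 * (r + 1))) ^ (-(1 / 100) : ℝ)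
      = ((1 / 4 : ℝ) ^ (1 / 5 : ℝ)) ^ (r + 1) := by
    rw [← Real.rpow_natCast, ← Real.rpow_mul (by norm_num), ← Real.rpow_natCast,
      ← Real.rpow_mul (by norm_num), show (1 / 4 : ℝ) = 2 ^ (-2 : ℝ) by
        rw [Real.rpow_neg (by norm_num)]; norm_num, ← Real.rpow_mul (by norm_num)]
    congr 1
    push_cast
    ring
  rw [h2]
  refine pow_le_pow_left₀ (by norm_num) ?_ _
  have h3 : (3 / 4 : ℝ) = ((3 / 4 : ℝ) ^ (5 : ℝ)) ^ (1 / 5 : ℝ) := by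
    rw [← Real.rpow_mul (by norm_num)]; norm_num
  rw [h3]
  exact Real.rpow_le_rpow (by positivity) (by norm_num) (by norm_num)

theorem sq_div_le_geometric {r : ℕ} {x : ℝ} (hx : (2 : ℝ) ^ (40 * r) ≤ x) :
    ((6 * r : ℕ) : ℝ) ^ 2 / x ≤ 36 * (7 / 10) ^ r := by
  have hrr : (r : ℝ) ≤ 2 ^ r := by exact_mod_cast Nat.lt_two_pow_self.le
  have hnum : ((6 * r : ℕ) : ℝ) ^ 2 ≤ 36 * (2 ^ r * 2 ^ r) := by
    push_cast
    rw [mul_pow, sq (r : ℝ)]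
    have := mul_le_mul hrr hrr (by positivity) (by positivity)
    linarith
  calc ((6 * r : ℕ) : ℝ) ^ 2 / x ≤ 36 * (2 ^ r * 2 ^ r) / 2 ^ (40 * r) :=
        div_le_div₀ (by positivity) hnum (by positivity) hx
    _ = 36 * (2 * 2 / 2 ^ 40) ^ r := by rw [div_pow, mul_pow, pow_mul, mul_div_assoc]
    _ ≤ 36 * (7 / 10) ^ r :=
        mul_le_mul_of_nonneg_left (pow_le_pow_left₀ (by norm_num) (by norm_num) _) (by norm_num)

theorem two_pow_mul_inv_sqrt_le (r : ℕ) :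
    (2 : ℝ) ^ (5 * r) * (1 / √(((2 ^ (20 * r) : ℕ) : ℝ) / 2)) ≤ 2 * (7 / 10) ^ r := by
  have h : (2 : ℝ) ^ (10 * r) / 2 ≤ √(((2 ^ (20 * r) : ℕ) : ℝ) / 2) := by
    refine Real.le_sqrt_of_sq_le ?_
    push_cast
    rw [div_pow, ← pow_mul, show 10 * r * 2 = 20 * r by ring]
    have : (0 : ℝ) < 2 ^ (20 * r) := by positivity
    linarith
  calc (2 : ℝ) ^ (5 * r) * (1 / √(((2 ^ (20 * r) : ℕ) : ℝ) / 2))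
      ≤ 2 ^ (5 * r) * (1 / (2 ^ (10 * r) / 2)) :=
        mul_le_mul_of_nonneg_left (one_div_le_one_div_of_le (by positivity) h) (by positivity)
    _ = 2 * (2 ^ 5 / 2 ^ 10) ^ r := by
        rw [div_pow, ← pow_mul, ← pow_mul, one_div_div, mul_div_assoc', mul_div_assoc',
          mul_comm]
    _ ≤ 2 * (7 / 10) ^ r :=
        mul_le_mul_of_nonneg_left (pow_le_pow_left₀ (by norm_num) (by norm_num) _) (by norm_num)

theorem pow_mul_mean_minor_count_le {r : ℕ} {x : ℝ} (hr : 4 ≤ r) (hx : (2 : ℝ) ^ (40 * r) ≤ x) :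
    (2 : ℝ) ^ (6 * r) * ((5 * r : ℕ) * (((2 ^ (20 * r) : ℕ) : ℝ) / x)) ≤ 1 / 2 := by
  have hrr : (r : ℝ) ≤ 2 ^ r := by exact_mod_cast Nat.lt_two_pow_self.le
  have h2 : (16 : ℝ) ≤ 2 ^ r :=
    le_trans (by norm_num) (pow_le_pow_right₀ one_le_two hr)
  have h5 : ((2 ^ (20 * r) : ℕ) : ℝ) / x ≤ 2 ^ (20 * r) / 2 ^ (40 * r) := by
    push_cast
    exact div_le_div_of_nonneg_left (by positivity) (by positivity) hx
  have h6 : ((5 * r : ℕ) : ℝ) ≤ 5 * 2 ^ r := by push_cast; linarith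
  calc (2 : ℝ) ^ (6 * r) * ((5 * r : ℕ) * (((2 ^ (20 * r) : ℕ) : ℝ) / x))
      ≤ 2 ^ (6 * r) * ((5 * 2 ^ r) * (2 ^ (20 * r) / 2 ^ (40 * r))) :=
        mul_le_mul_of_nonneg_left
          (mul_le_mul h6 h5 (div_nonneg (by positivity) ((by positivity : (0 : ℝ) ≤ _).trans hx))
            (by positivity)) (by positivity)
    _ = 5 * 2 ^ (27 * r) / 2 ^ (40 * r) := by
        rw [show 27 * r = 6 * r + r + 20 * r by ring, pow_add, pow_add]; ring
    _ ≤ 1 / 2 := by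
        rw [div_le_div_iff₀ (by positivity) (by norm_num),
          show 40 * r = 27 * r + (12 * r + r) by ring, pow_add, pow_add 2 (12 * r)]
        have h3 : (1 : ℝ) ≤ 2 ^ (12 * r) := one_le_pow₀ one_le_two
        have h4 : (0 : ℝ) < 2 ^ (27 * r) := by positivity
        nlinarith [mul_le_mul h3 h2 (by norm_num) (by positivity)]

theorem failure_bound_le_rpow {r n : ℕ} (hr : 100 ≤ r) (hn : 2 ^ (40 * r) ≤ n)
    (hn' : n < 2 ^ (40 * (r + 1))) :
    2 * ((4 / 3 * (1 / 2) ^ r + (1 / 2) ^ r) + 2 ^ r * (5 / 6) ^ (6 * r)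
      + ((6 * r : ℕ) : ℝ) ^ 2 / n) + 2 ^ (5 * r) * (1 / √(((2 ^ (20 * r) : ℕ) : ℝ) / 2))
      ≤ (n : ℝ) ^ (-(1 / 100) : ℝ) := by
  have hn0 : 0 < n := lt_of_lt_of_le (by positivity) hn
  refine le_trans ?_ (three_quarters_pow_le_rpow hn0 hn')
  have h1 : (1 / 2 : ℝ) ^ r ≤ (7 / 10) ^ r := pow_le_pow_left₀ (by norm_num) (by norm_num) _
  have h2 : (2 : ℝ) ^ r * (5 / 6) ^ (6 * r) ≤ (7 / 10) ^ r := by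
    rw [pow_mul, ← mul_pow]
    exact pow_le_pow_left₀ (by norm_num) (by norm_num) _
  have h3 := sq_div_le_geometric (r := r) (x := n) (by exact_mod_cast hn)
  have h4 := two_pow_mul_inv_sqrt_le r
  -- All terms together are at most (2(7/3 + 1 + 36) + 2)(7/10)^r, with coefficient below 81 = 108 ·
  -- 3/4.
  have h6 : (108 : ℝ) ≤ (15 / 14) ^ r :=
    le_trans (by norm_num) (pow_le_pow_right₀ (by norm_num) hr : (15 / 14 : ℝ) ^ 100 ≤ _)
  have h7 : (3 / 4 : ℝ) ^ (r + 1) = 3 / 4 * ((15 / 14) ^ r * (7 / 10) ^ r) := by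
    rw [← mul_pow, pow_succ]; norm_num; ring
  rw [h7]
  have h9 : (0 : ℝ) ≤ (7 / 10) ^ r := by positivity
  have h8 := mul_le_mul_of_nonneg_right h6 (by positivity : (0 : ℝ) ≤ (7 / 10) ^ r)
  generalize (2 : ℝ) ^ r * (5 / 6) ^ (6 * r) = a at *
  generalize (15 / 14 : ℝ) ^ r * (7 / 10) ^ r = b at *
  generalize (7 / 10 : ℝ) ^ r = x at *
  generalize (1 / 2 : ℝ) ^ r = y at *
  generalize ((6 * r : ℕ) : ℝ) ^ 2 / n = z at *
  generalize (2 : ℝ) ^ (5 * r) * (1 / √(((2 ^ (20 * r) : ℕ) : ℝ) / 2)) = w at *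
  linarith

/-- The losses amount to at most n^(6q) with q ≤ εn + 1. Of the 12εn saved in the exponent of the
square, 6εn pays for these, εn for the exponent of the growth factor, and the rest absorbs 6r + 6.
-/
theorem rpow_sq_le_energy_bound {ε : ℝ} (hε : 0 < ε) {n N r q : ℕ}
    (hn : 4 ≤ n) (hN : n = 5 * r + N) (hr : 8 * (r : ℝ) ≤ ε * n) (hεn : 2 ≤ ε * n)
    (hq : (q : ℝ) ≤ ε * n + 1) (hrq : r ≤ q) (hrN : r ≤ N) (hN0 : 0 < N) :
    ((n : ℝ) ^ ((1 / 2 - 6 * ε) * n)) ^ 2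
      ≤ ((n : ℝ) ^ (1 - ε)) ^ (N - r) / ((n : ℝ) ^ (1 - ε) * (4 * N)) ^ (q + (q - r))
        / (4 * N) ^ r := by
  have hn4 : (4 : ℝ) ≤ n := by exact_mod_cast hn
  have hn1 : (1 : ℝ) ≤ n := by linarith
  have hn0 : (0 : ℝ) < n := by linarith
  have hNn : (N : ℝ) ≤ n := by exact_mod_cast (by omega : N ≤ n)
  have hN0' : (0 : ℝ) < N := by exact_mod_cast hN0
  have hG : (n : ℝ) ^ (1 - ε) ≤ n := by
    conv_rhs => rw [← Real.rpow_one (n : ℝ)]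
    exact Real.rpow_le_rpow_of_exponent_le hn1 (by linarith)
  have h4N : (4 * N : ℝ) ≤ n ^ 2 := by nlinarith
  have hGH : (n : ℝ) ^ (1 - ε) * (4 * N) ≤ n ^ 3 := by
    calc (n : ℝ) ^ (1 - ε) * (4 * N) ≤ n * n ^ 2 := by gcongr
      _ = n ^ 3 := by ring
  rw [div_div]
  rw [le_div_iff₀ (by positivity)]
  have hden : ((n : ℝ) ^ (1 - ε) * (4 * N)) ^ (q + (q - r)) * (4 * N) ^ r ≤ (n : ℝ) ^ (6 * q) := by
    calc _ ≤ ((n : ℝ) ^ 3) ^ (q + (q - r)) * (n ^ 2) ^ r := by gcongr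
      _ = (n : ℝ) ^ (3 * (q + (q - r)) + 2 * r) := by rw [← pow_mul, ← pow_mul, ← pow_add]
      _ ≤ _ := pow_le_pow_right₀ hn1 (by omega)
  refine (mul_le_mul_of_nonneg_left hden (by positivity)).trans ?_
  rw [← Real.rpow_natCast, ← Real.rpow_natCast, ← Real.rpow_natCast, ← Real.rpow_mul hn0.le,
    ← Real.rpow_mul hn0.le, ← Real.rpow_add hn0]
  refine Real.rpow_le_rpow_of_exponent_le hn1 ?_
  have hcast : ((N - r : ℕ) : ℝ) = n - 6 * r := by
    rw [Nat.cast_sub hrN, hN]; push_cast; ring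
  rw [hcast]
  push_cast
  have hr0 : (0 : ℝ) ≤ r := by positivity
  nlinarith [mul_nonneg hε.le hr0]

/-- Growth by n^(1-ε), slightly less than linear, is what makes the failure probability tend to 0,
like n^(-ε/2) for small ε. -/
theorem growth_failure_le {ε : ℝ} (hε : 0 < ε) {n N q : ℕ} (hn : 0 < n) (hN : N ≤ n)
    (hq : ε * n ≤ q) :
    40 * ((16 * √(2 * N * (n : ℝ) ^ (1 - ε) / q) + 1) / √((q : ℝ) / 48))
      ≤ 40 * (16 * √(96 / ε ^ 2 * (n : ℝ) ^ (-ε)) + (√(ε / 48 * n))⁻¹) := by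
  have hn0 : (0 : ℝ) < n := by exact_mod_cast hn
  have hNn : (N : ℝ) ≤ n := by exact_mod_cast hN
  have hεn : 0 < ε * n := by positivity
  have h1 : √(96 / ε ^ 2 * (n : ℝ) ^ (-ε))
      = √(2 * n * (n : ℝ) ^ (1 - ε) / (ε * n)) / √((ε * n) / 48) := by
    rw [← Real.sqrt_div (by positivity), Real.rpow_sub hn0, Real.rpow_one, Real.rpow_neg hn0.le]
    congr 1
    field_simp
    norm_num
  have h2 : (16 * √(2 * n * (n : ℝ) ^ (1 - ε) / (ε * n)) + 1) / √((ε * n) / 48)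
      = 16 * √(96 / ε ^ 2 * (n : ℝ) ^ (-ε)) + (√(ε / 48 * n))⁻¹ := by
    rw [h1, add_div, one_div, mul_div_assoc, mul_div_right_comm ε]
  rw [← h2]
  gcongr

theorem tendsto_growth_failure {ε : ℝ} (hε : 0 < ε) :
    Filter.Tendsto
      (fun n : ℕ => 40 * (16 * √(96 / ε ^ 2 * (n : ℝ) ^ (-ε)) + (√(ε / 48 * n))⁻¹))
      Filter.atTop (nhds 0) := by
  have h1 : Filter.Tendsto (fun n : ℕ => (n : ℝ) ^ (-ε)) Filter.atTop (nhds 0) :=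
    (tendsto_rpow_neg_atTop hε).comp tendsto_natCast_atTop_atTop
  have h2 : Filter.Tendsto (fun n : ℕ => √(96 / ε ^ 2 * (n : ℝ) ^ (-ε))) Filter.atTop
      (nhds 0) := by
    have := (Real.continuous_sqrt.tendsto _).comp (h1.const_mul (96 / ε ^ 2))
    rw [mul_zero, Real.sqrt_zero] at this
    exact this
  have h3 : Filter.Tendsto (fun n : ℕ => (√(ε / 48 * n))⁻¹) Filter.atTop (nhds 0) :=
    tendsto_inv_atTop_zero.comp (Real.tendsto_sqrt_atTop.comp
      (tendsto_natCast_atTop_atTop.const_mul_atTop (by positivity)))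
  have := ((h2.const_mul 16).add h3).const_mul 40
  simpa using this

theorem eight_mul_le {ε x : ℝ} {r : ℕ} (hε : 0 < ε) (h1 : 8 / ε ≤ 2 ^ r)
    (h2 : (2 : ℝ) ^ (r + r) ≤ x) : 8 * (r : ℝ) ≤ ε * x := by
  have hr : (r : ℝ) ≤ 2 ^ r := by exact_mod_cast Nat.lt_two_pow_self.le
  calc 8 * (r : ℝ) = ε * (8 / ε * r) := by field_simp
    _ ≤ ε * (2 ^ r * 2 ^ r) := mul_le_mul_of_nonneg_left
        (mul_le_mul h1 hr (by positivity) (by positivity)) hε.le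
    _ ≤ ε * x := by rw [← pow_add]; exact mul_le_mul_of_nonneg_left h2 hε.le

theorem unifProb_abs_permanent_lt_rpow_le {ε : ℝ} (hε : 0 < ε) (hε' : ε ≤ 1 / 20) :
    ∃ n₀ : ℕ, ∀ n : ℕ, n₀ ≤ n →
      unifProb (fun X : Fin n → Fin n → Bool =>
        |(Matrix.of fun i j => boolSign (X i j)).permanent| < (n : ℝ) ^ ((1 / 2 - 6 * ε) * n))
      ≤ (n : ℝ) ^ (-(1 / 100) : ℝ) := by
  -- Since kq ≥ n, a failure rate below 4^(-k) gives η^q ≤ 4^(-n), which beats the entropy factor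
  -- 2^N.
  obtain ⟨k, hk⟩ := exists_nat_ge (1 / ε)
  obtain ⟨R, hR⟩ := pow_unbounded_of_one_lt (8 / ε) (one_lt_two : (1 : ℝ) < 2)
  obtain ⟨n₁, hn₁⟩ := Filter.eventually_atTop.1
    ((tendsto_growth_failure hε).eventually_le_const (show (0 : ℝ) < (1 / 4) ^ k by positivity))
  obtain ⟨T, hT⟩ : ∃ T, T = 2 ^ (40 * (R + 100)) := ⟨_, rfl⟩
  refine ⟨max n₁ T, fun n hn => ?_⟩
  have hnn₁ : n₁ ≤ n := (le_max_left _ _).trans hn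
  have hTn : T ≤ n := (le_max_right _ _).trans hn
  have hn0 : 0 < n := lt_of_lt_of_le (by rw [hT]; exact Nat.two_pow_pos _) hTn
  -- Then 2^(40r) ≤ n < 2^(40(r+1)), so the branching number 2^(20r) is about √n: large against 4^s
  -- = 2^(10r), yet small enough that 2^t · s · m / n ≤ 1/2.
  obtain ⟨r, hrdef⟩ : ∃ r, r = Nat.log 2 n / 40 := ⟨_, rfl⟩
  have hrR : R + 100 ≤ r := by
    have := Nat.le_log_of_pow_le one_lt_two (hT ▸ hTn)
    omega
  clear hT hTn
  have hnpos : (0 : ℝ) < n := by exact_mod_cast hn0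
  have h8 : 8 * (r : ℝ) ≤ ε * n := by
    have h1 : 8 / ε ≤ 2 ^ r := hR.le.trans (pow_le_pow_right₀ one_le_two (by omega))
    have h2 : 2 ^ (r + r) ≤ n :=
      (Nat.pow_le_pow_right two_pos (by omega)).trans (Nat.pow_log_le_self 2 hn0.ne')
    exact eight_mul_le hε h1 (by exact_mod_cast h2)
  have hr100 : (100 : ℝ) ≤ r := by exact_mod_cast (by omega : 100 ≤ r)
  set q := ⌈ε * n⌉₊ with hqdef
  have hq1 : ε * n ≤ q := Nat.le_ceil _
  have hq2 : (q : ℝ) ≤ ε * n + 1 := (Nat.ceil_lt_add_one (by positivity)).le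
  have hεn : ε * n ≤ n / 20 := by nlinarith
  have hrq : r ≤ q := by
    have : (r : ℝ) ≤ q := by linarith
    exact_mod_cast this
  have hqn : q + 5 * r ≤ n := by
    have : (q : ℝ) + 5 * r ≤ n := by linarith
    exact_mod_cast this
  obtain ⟨N, hN⟩ : ∃ N, n = 5 * r + N := ⟨n - 5 * r, by omega⟩
  have hqN : q ≤ N := by omega
  have hn4 : 4 ≤ n := by omega
  have hGH : 1 ≤ (n : ℝ) ^ (1 - ε) * (4 * N) := by
    have h1 : 1 ≤ (n : ℝ) ^ (1 - ε) :=
      Real.one_le_rpow (by exact_mod_cast hn0) (by linarith)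
    have h2 : (1 : ℝ) ≤ N := by exact_mod_cast (by omega : 1 ≤ N)
    nlinarith
  have hu := unifProb_energy_lt_le hrq (by omega) hqN (Real.rpow_pos_of_pos hnpos (1 - ε)) hGH q
  set η := 40 * ((16 * √(2 * N * (n : ℝ) ^ (1 - ε) / q) + 1) / √((q : ℝ) / 48)) with hη
  have hη0 : 0 ≤ η := by positivity
  have hηk : η ≤ (1 / 4) ^ k := (growth_failure_le hε hn0 (by omega) hq1).trans (hn₁ n hnn₁)
  have hηq : (2 : ℝ) ^ N * η ^ q ≤ (1 / 2) ^ r := by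
    have hkq : n ≤ k * q := by
      have : (n : ℝ) ≤ k * q := by
        calc (n : ℝ) = 1 / ε * (ε * n) := by field_simp
          _ ≤ k * q := by gcongr
      exact_mod_cast this
    calc (2 : ℝ) ^ N * η ^ q ≤ 2 ^ n * ((1 / 4) ^ k) ^ q := by
          gcongr
          · norm_num
          · omega
      _ ≤ 2 ^ n * (1 / 4) ^ n := by
          rw [← pow_mul]
          exact mul_le_mul_of_nonneg_left
            (pow_le_pow_of_le_one (by norm_num) (by norm_num) hkq) (by positivity)
      _ = (1 / 2) ^ n := by rw [← mul_pow]; norm_num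
      _ ≤ (1 / 2) ^ r := pow_le_pow_of_le_one (by norm_num) (by norm_num) (by omega)
  have hδ : (0 : ℝ) ≤ 4 / 3 * (1 / 2) ^ r + (1 / 2) ^ r := by positivity
  have hrn : 2 ^ (40 * r) ≤ n :=
    (Nat.pow_le_pow_right (by norm_num) (by omega)).trans (Nat.pow_log_le_self 2 hn0.ne')
  have hnr : n < 2 ^ (40 * (r + 1)) :=
    (Nat.lt_pow_succ_log_self one_lt_two n).trans_le
      (Nat.pow_le_pow_right (by norm_num) (by omega))
  have hm : (2 : ℝ) ^ (6 * r) * ((5 * r : ℕ) * (((2 ^ (20 * r) : ℕ) : ℝ) / n)) ≤ 1 / 2 :=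
    pow_mul_mean_minor_count_le (by omega) (by exact_mod_cast hrn)
  have hmain := unifProb_abs_permanent_lt_le (t := 6 * r) (m := 2 ^ (20 * r)) (hrq.trans hqN)
    (by ring) hN hn0 (Nat.two_pow_pos _) (Real.rpow_pos_of_pos hnpos ((1 / 2 - 6 * ε) * n))
    (rpow_sq_le_energy_bound hε hn4 hN h8 (by linarith) hq2 hrq (hrq.trans hqN)
      (by omega))
    (δ := 4 / 3 * (1 / 2) ^ r + (1 / 2) ^ r) hδ (hu.trans (by linarith)) hm
  exact hmain.trans (failure_bound_le_rpow (by omega) hrn hnr)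

theorem theorem2 :
    ∃ c : ℝ, 0 < c ∧ ∀ ε : ℝ, 0 < ε → ∃ n₀ : ℕ, ∀ n : ℕ, n₀ ≤ n →
      ∀ (Ω : Type*) [MeasurableSpace Ω] (μ : Measure Ω) [IsProbabilityMeasure μ]
        (M : Ω → Matrix (Fin n) (Fin n) ℝ), IsBernoulliMatrix μ M →
        1 - (n : ℝ) ^ (-c) ≤
          μ.real {ω | (n : ℝ) ^ ((1 / 2 - ε) * (n : ℝ)) ≤ |(M ω).permanent|} := by
  refine ⟨1 / 100, by norm_num, fun ε hε => ?_⟩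
  -- Division by 6 matches the exponent 1/2 - 6ε; the cap 1/20 leaves room for q + 5r ≤ n.
  obtain ⟨n₀, h⟩ := unifProb_abs_permanent_lt_rpow_le (ε := min (ε / 6) (1 / 20))
    (by positivity) (min_le_right _ _)
  refine ⟨max n₀ 1, fun n hn Ω _ μ _ M hM => ?_⟩
  have hn1 : (1 : ℝ) ≤ n := by exact_mod_cast (le_max_right n₀ 1).trans hn
  refine le_trans ?_ (hM.unifProb_le fun A => (n : ℝ) ^ ((1 / 2 - ε) * (n : ℝ)) ≤ |A.permanent|)
  have h1 := h n ((le_max_left _ _).trans hn)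
  have h2 := unifProb_add_not (fun X : Fin n → Fin n → Bool =>
    (n : ℝ) ^ ((1 / 2 - ε) * (n : ℝ)) ≤ |(Matrix.of fun i j => boolSign (X i j)).permanent|)
  have h3 : unifProb (fun X : Fin n → Fin n → Bool => ¬ (n : ℝ) ^ ((1 / 2 - ε) * (n : ℝ)) ≤
        |(Matrix.of fun i j => boolSign (X i j)).permanent|)
      ≤ unifProb (fun X : Fin n → Fin n → Bool =>
        |(Matrix.of fun i j => boolSign (X i j)).permanent|
          < (n : ℝ) ^ ((1 / 2 - 6 * min (ε / 6) (1 / 20)) * n)) := by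
    refine unifProb_mono fun X hX => (not_le.1 hX).trans_le ?_
    refine Real.rpow_le_rpow_of_exponent_le hn1 (mul_le_mul_of_nonneg_right ?_ (by linarith))
    linarith [min_le_left (ε / 6) (1 / 20 : ℝ)]
  linarith
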